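/- For a language $L\subseteq\Sigma^*$ over a finite alphabet $\Sigma$, the (left) quotient of $L$ by $w\in\Sigma^*$ is $w^{-1}L=\{x\mid wx\in L\}$, and the complexity $\kappa(L)$ is the number of distinct quotients of $L$. A language is prefix-free if none of its words is a prefix of another of its words. The atoms of $L$ are the equivalence classes of the relation on $\Sigma^*$ under which $x$ and $y$ are equivalent if, for all $u\in\Sigma^*$, $ux\in L\iff uy\in L$. A DFA is minimal if all its states are reachable and distinct states accept distinct languages. For $n\ge 4$ let $\mathcal D_n$ be the DFA with states $\{0,\dots,n-1\}$, initial state $0$, single final state $n-2$ and alphabet $\Sigma=\{a,c,d,e,f,g\}$. Every letter sends $n-2$ to $n-1$ and fixes $n-1$; on the states $0,\dots,n-3$ the letters act as follows: * $a$ is the cycle $0\to 1\to\dots\to n-3\to 0$; * $c$ sends $1$ to $0$ and fixes the other states; * $d$ sends $0$ to $n-2$ and every other state to $n-1$; * $e$ sends $n-3$ to $n-2$ and fixes the other states; * $f$ sends each $q$ to $q+1$; * $g$ fixes every state. Let $L_n=L_n(a,c,d,e,f,g)$ be the language accepted by $\mathcal D_n$. For a partial map $\pi$ from $\Sigma$ to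 an alphabet $\Sigma'$, the dialect $L_n(\pi(a),\pi(c),\pi(d),\pi(e),\pi(f),\pi(g))$ is the language over $\Sigma'$ obtained from $L_n$ by replacing each letter $x$ by $\pi(x)$ in every word and deleting every word containing a letter at which $\pi$ is undefined; undefined values are written $-$, and omitted at the end of the list. The alphabet of each dialect, or pair of dialects, below consists of the letters that are written. **Proposition.** For $n\ge4$, the DFA $\mathcal D_n$ is minimal and $L_n$ is a prefix-free language of complexity $n$. For all $m,n\ge 4$, the dialects below are prefix-free languages of complexity $m$ (those of $L_m$) or $n$ (those of $L_n$), and they meet the bounds stated. Each bound is an upper bound for all prefix-free languages of complexity $n$ over any finite alphabet, or, for a binary operation, for all pairs of prefix-free languages of complexities $m$ and $n$, in this order, over a common finite alphabet. 1. The quotients of $L_n(a,-,-,-,f)$ have complexity $n$, except for the quotients $\{\varepsilon\}$ and $\emptyset$, which both occur and have complexities $2$ and $1$. 2. The reverse of $L_n(a,c,-,e)$ has complexity $2^{n-2}+1$, and $L_n(a,c,-,e)$ has $2^{n-2}+1$ atoms. 3. The star of $L_n(a,-,d)$ has complexity $n$. 4. The product $L_m(-,-,-,-,f)\,L_n(-,-,-,-,f)$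 has complexity $m+n-2$. 5. (a) The languages $L_m(-,-,-,-,f,g)\cup L_n(-,-,-,-,g,f)$ and $L_m(-,-,-,-,f,g)\oplus L_n(-,-,-,-,g,f)$ have complexity $mn-2$. (b) The difference $L_m(a,-,-,e)\setminus L_n(-,-,-,-,e,a)$ has complexity $mn-(m+2n-4)$. (c) The intersection $L_m(a,-,-,e)\cap L_n(-,-,-,-,e,a)$ has complexity $mn-2(m+n-3)$. Moreover, the alphabets of these witnesses are minimal: for every $n\ge4$ (and every $m\ge 4$ for the binary operations) no prefix-free language of complexity $n$ (no pair of prefix-free languages of complexities $m$ and $n$) over an alphabet, or common alphabet, with fewer letters attains the same values. That is, two letters are needed in 1, 3, 5(a), 5(b) and 5(c), and one letter in 4. In 2, for the reverse as well as for the number of atoms, three letters are needed for every $n\ge5$ (for $n=4$ the value $2^{n-2}+1=5$ is also attained over two letters). -/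

import Mathlib

open scoped Computability symmDiff

namespace PrefixFreeStream

/-- The quotient complexity `κ(L)`: the number of distinct (left) quotients `w⁻¹L`.  It lies in `ℕ∞`,
so `κ L = n` with `n` a natural number says in particular that `L` is regular. -/
noncomputable def κ {α : Type} (L : Language α) : ℕ∞ :=
  (Set.range L.leftQuotient).encard

/-- No word of `L` is a prefix of another word of `L`. -/
def PrefixFree {α : Type} (L : Language α) : Prop :=
  ∀ u ∈ L, ∀ v ∈ L, u <+: v → u = v

/-- `L` is a prefix-free language of complexity `n`. -/
def IsPrefixFreeOf (n : ℕ) {α : Type} (L : Language α) : Prop :=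
  PrefixFree L ∧ κ L = n

/-- The atoms of `L`: the classes of the left congruence that relates `x` and `y` if
`ux ∈ L ↔ uy ∈ L` for all words `u`. -/
def atoms {α : Type} (L : Language α) : Set (Set (List α)) :=
  Set.range fun x : List α => {y | ∀ u : List α, u ++ x ∈ L ↔ u ++ y ∈ L}

/-- A DFA is minimal if all its states are reachable and no two states are equivalent. -/
def IsMinimal {α σ : Type} (M : DFA α σ) : Prop :=
  (∀ q : σ, ∃ w : List α, M.eval w = q) ∧
    ∀ p q : σ, M.acceptsFrom p = M.acceptsFrom q → p = q

/-- The dialect of `L` given by a partial map `π` of letters: replace each letter `x` by `π x` in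
every word of `L`, and delete the words with a letter at which `π` is undefined (`none`). -/
def dialect {α β : Type} (π : α → Option β) (L : Language α) : Language β :=
  {w | ∃ v ∈ L, v.map π = w.map some}

/-- The six letters of the stream, in this order. -/
inductive Letter
  | a | c | d | e | f | g

/-- The transformation of `{0, …, n-1}` induced by each letter (for `n ≥ 4`). -/
def act (n : ℕ) : Letter → ℕ → ℕ
  -- the cycle `(0, …, n-3)`, and `n-2 → n-1`
  | .a, q => if q < n - 3 then q + 1 else if q = n - 3 then 0 else n - 1
  -- `1 → 0` and `n-2 → n-1`
  | .c, q => if q = 1 then 0 else if q = n - 2 then n - 1 else q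
  -- `0 → n-2`, and every other state to `n-1`
  | .d, q => if q = 0 then n - 2 else n - 1
  -- `n-3 → n-2` and `n-2 → n-1`
  | .e, q => if q = n - 3 then n - 2 else if q = n - 2 then n - 1 else q
  -- `q → q+1` for `0 ≤ q ≤ n-2`
  | .f, q => if q ≤ n - 2 then q + 1 else q
  -- `n-2 → n-1`
  | .g, q => if q = n - 2 then n - 1 else q

theorem act_lt {n : ℕ} (hn : 4 ≤ n) (x : Letter) {q : ℕ} (hq : q < n) : act n x q < n := by
  cases x <;> simp only [act] <;> split_ifs <;> omega

/-- The DFA `𝒟ₙ(a,c,d,e,f,g)` with states `0, …, n-1`, initial state `0` and final state `n-2`. -/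
def streamDFA (n : ℕ) (hn : 4 ≤ n) : DFA Letter (Fin n) where
  step q x := ⟨act n x q, act_lt hn x q.isLt⟩
  start := ⟨0, by omega⟩
  accept := {⟨n - 2, by omega⟩}

/-- The language `Lₙ(a,c,d,e,f,g)`. -/
def stream (n : ℕ) (hn : 4 ≤ n) : Language Letter :=
  (streamDFA n hn).accepts

/-- The dialect `Lₙ(a,c,d,e,f,g)`, where the arguments are the images in a new alphabet `β` of the
six letters, in their order; the argument `none` stands for the usual dash. -/
def streamDialect (n : ℕ) (hn : 4 ≤ n) {β : Type} (a c d e f g : Option β) : Language β :=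
  dialect
    (fun x => match x with
      | .a => a
      | .c => c
      | .d => d
      | .e => e
      | .f => f
      | .g => g)
    (stream n hn)

/-- Every quotient of `L` has complexity `n`, except for the quotients `{ε}` and `∅`, which both occur
and have complexity `2` and `1`, respectively. -/
def QuotientsMeet (n : ℕ) {α : Type} (L : Language α) : Prop :=
  (∃ w, L.leftQuotient w = 1) ∧ (∃ w, L.leftQuotient w = 0) ∧
    ∀ w, (L.leftQuotient w = 1 → κ (L.leftQuotient w) = 2) ∧
      (L.leftQuotient w = 0 → κ (L.leftQuotient w) = 1) ∧
      (L.leftQuotient w ≠ 1 → L.leftQuotient w ≠ 0 → κ (L.leftQuotient w) = n)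

/-- The corresponding upper bounds on the complexity of the quotients of `L`. -/
def QuotientsBounded (n : ℕ) {α : Type} (L : Language α) : Prop :=
  ∀ w, (L.leftQuotient w = 1 → κ (L.leftQuotient w) ≤ 2) ∧
    (L.leftQuotient w = 0 → κ (L.leftQuotient w) ≤ 1) ∧ κ (L.leftQuotient w) ≤ n

/-- `B` is an upper bound for the measure `μ` of the prefix-free languages of complexity `n`, over all
finite alphabets, and the prefix-free language `W` of complexity `n` meets it. -/
def Meets₁ (μ : (α : Type) → Language α → ℕ∞) (n B : ℕ) {α : Type} (W : Language α) : Prop :=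
  (∀ (β : Type) [Finite β] (L : Language β), IsPrefixFreeOf n L → μ β L ≤ B) ∧
    IsPrefixFreeOf n W ∧ μ α W = B

/-- No prefix-free language of complexity `n` over an alphabet with fewer than `k` letters attains the
value `B` of the measure `μ`. -/
def NeedsLetters₁ (μ : (α : Type) → Language α → ℕ∞) (n B k : ℕ) : Prop :=
  ∀ (β : Type) [Finite β] (L : Language β), IsPrefixFreeOf n L → μ β L = B → k ≤ Nat.card β

/-- `B` is an upper bound for the complexity of `L' ∘ L`, for prefix-free `L'` and `L` of complexities
`m` and `n` over any finite alphabet, and the prefix-free languages `W'` and `W` of complexities `m`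
and `n` meet it. -/
def Meets₂ (op : (α : Type) → Language α → Language α → Language α) (m n B : ℕ) {α : Type}
    (W' W : Language α) : Prop :=
  (∀ (β : Type) [Finite β] (L' L : Language β), IsPrefixFreeOf m L' → IsPrefixFreeOf n L →
      κ (op β L' L) ≤ B) ∧
    IsPrefixFreeOf m W' ∧ IsPrefixFreeOf n W ∧ κ (op α W' W) = B

/-- No prefix-free languages `L'` and `L` of complexities `m` and `n` over a (combined) alphabet with
fewer than `k` letters attain the complexity `B` of `L' ∘ L`. -/
def NeedsLetters₂ (op : (α : Type) → Language α → Language α → Language α) (m n B k : ℕ) : Prop :=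
  ∀ (β : Type) [Finite β] (L' L : Language β), IsPrefixFreeOf m L' → IsPrefixFreeOf n L →
    κ (op β L' L) = B → k ≤ Nat.card β

end PrefixFreeStream

namespace PrefixFreeStream

/-! ### Quotients of prefix-free languages -/

/-! A prefix-free language of complexity `n` has the quotients `∅` and `{ε}` and `n - 2` others,
none of which contains `ε` (`IsPrefixFreeOf.exists_finset`). The upper bounds come from following
how quotients combine. In a product `L'L`, the first factor hands over to `L` exactly when it
becomes `{ε}`; in a star, `{ε}` restarts `L`. For a boolean operation the quotients are combinations
of pairs of quotients, and pairs that involve `∅` or `{ε}` partly coincide. For the reverse, the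
left context `{u | ux ∈ L}` is determined by the set of quotients that contain `x`: either `x = ε`,
or `x ≠ ε` and only a subset of the `n - 2` others matters, which gives `2^(n-2) + 1`
(`κ_reverse_le_signature`). The atoms are the fibres of the left-context map, so their number is the
complexity of the reverse.

For the lower bounds, a dialect is the language of state `0` under a choice `σ` of acting letters
(`dialect_eq`, `stateLang`). Explicit words reach the required states or pairs of states, and others
are accepted from exactly one of them. For the reverse, each set of states below `n - 2` is realized
as the set accepting some nonempty word: `{0}` is enlarged to all states by a map that merges
neighbours (`IsAcceptingSet.copy`), then unwanted states are killed one by one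
(`IsAcceptingSet.erase`).

Over one letter the only prefix-free language of complexity `n` consists of the word of length `n -
2`, and its combinations are too simple whenever two letters are claimed. That two letters are too
few for reversal when `n ≥ 5` is a statement about two partial maps of a set with at least three
elements (`not_forall_exists_accepting_eq`): the demand that every subset occur as an accepting set
forces, through the full set, one letter to be accepting everywhere or total, and then too few sets
can arise. -/

theorem κ_le_of_range_subset {β : Type} {L : Language β} (s : Finset (Language β))
    (h : ∀ w, L.leftQuotient w ∈ s) : κ L ≤ s.card := by
  rw [← Set.encard_coe_eq_coe_finsetCard]
  exact Set.encard_le_encard (Set.range_subset_iff.2 h)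

theorem le_κ_of_injOn {β ι : Type} {L : Language β} (s : Finset ι) (f : ι → Language β)
    (hf : Set.InjOn f s) (h : ∀ i ∈ s, ∃ w, L.leftQuotient w = f i) : (s.card : ℕ∞) ≤ κ L := by
  rw [← Set.encard_coe_eq_coe_finsetCard, ← hf.encard_image]
  refine Set.encard_le_encard ?_
  rintro _ ⟨i, hi, rfl⟩
  exact h i hi

theorem exists_leftQuotient_leftQuotient {β : Type} {L : Language β} {K : Language β}
    (hK : K ∈ Set.range L.leftQuotient) (w : List β) :
    K.leftQuotient w ∈ Set.range L.leftQuotient := by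
  obtain ⟨v, rfl⟩ := hK
  exact ⟨v ++ w, Language.leftQuotient_append _ _ _⟩

theorem leftQuotient_zero {β : Type} (w : List β) : (0 : Language β).leftQuotient w = 0 := by
  ext x
  simp

theorem leftQuotient_one_cons {β : Type} (b : β) (w : List β) :
    (1 : Language β).leftQuotient (b :: w) = 0 := by
  ext x
  simp [Language.mem_one]

theorem PrefixFree.eq_one {β : Type} {L : Language β} (h : PrefixFree L) {K : Language β}
    (hK : K ∈ Set.range L.leftQuotient) (hnil : [] ∈ K) : K = 1 := by
  obtain ⟨w, rfl⟩ := hK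
  ext x
  rw [Language.mem_one]
  constructor
  · intro hx
    have := h _ hnil _ hx (by simp)
    simpa using this
  · rintro rfl
    exact hnil

/-- The quotients of a prefix-free language of complexity `n ≥ 4` are `∅`, `{ε}`, and `n - 2` others,
which do not contain `ε`. -/
theorem IsPrefixFreeOf.exists_finset {β : Type} {n : ℕ} {L : Language β} (hn : 4 ≤ n)
    (h : IsPrefixFreeOf n L) : ∃ P : Finset (Language β), P.card = n - 2 ∧ (∀ K ∈ P, [] ∉ K) ∧
      0 ∉ P ∧ Set.range L.leftQuotient = insert 0 (insert 1 (P : Set (Language β))) := by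
  classical
  obtain ⟨hpf, hκ⟩ := h
  have hfin : (Set.range L.leftQuotient).Finite := Set.finite_of_encard_eq_coe hκ
  -- More than one quotient exists, so `L` has a word and the alphabet has a letter. A word of `L`
  -- yields the quotient `{ε}`, and one more letter yields `∅`.
  have hbig : ∀ K, ¬ Set.range L.leftQuotient ⊆ {K} := fun K hK => by
    have := Set.encard_le_encard hK
    rw [Set.encard_singleton] at this
    rw [κ] at hκ
    rw [hκ] at this
    norm_cast at this
    omega
  obtain ⟨w, hw⟩ : ∃ w, w ∈ L := by
    by_contra hcon
    push Not at hcon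
    refine hbig 0 ?_
    rintro _ ⟨v, rfl⟩
    rw [Set.mem_singleton_iff]
    ext x
    simp [hcon]
  have hone : L.leftQuotient w = 1 := hpf.eq_one ⟨w, rfl⟩ (by simpa using hw)
  obtain ⟨b⟩ : Nonempty β := by
    by_contra hcon
    rw [not_nonempty_iff] at hcon
    refine hbig L ?_
    rintro _ ⟨v, rfl⟩
    rw [Subsingleton.elim v []]
    rfl
  have hzero : L.leftQuotient (w ++ [b]) = 0 := by
    rw [Language.leftQuotient_append, hone, leftQuotient_one_cons]
  have h1 : (1 : Language β) ∈ hfin.toFinset := hfin.mem_toFinset.2 ⟨w, hone⟩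
  have h01 : (0 : Language β) ≠ 1 := fun h => by
    have : [] ∈ (1 : Language β) := Language.nil_mem_one
    rw [← h] at this
    exact Language.notMem_zero _ this
  have h0 : (0 : Language β) ∈ hfin.toFinset.erase 1 :=
    Finset.mem_erase.2 ⟨h01, hfin.mem_toFinset.2 ⟨_, hzero⟩⟩
  have hcard : hfin.toFinset.card = n := by
    rw [κ, hfin.encard_eq_coe_toFinset_card] at hκ
    exact_mod_cast hκ
  refine ⟨(hfin.toFinset.erase 1).erase 0, ?_, ?_, by simp, ?_⟩
  · rw [Finset.card_erase_of_mem h0, Finset.card_erase_of_mem h1, hcard]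
    omega
  · intro K hK hnil
    simp only [Finset.mem_erase, Set.Finite.mem_toFinset] at hK
    exact hK.2.1 (hpf.eq_one hK.2.2 hnil)
  · have := congrArg (fun s : Finset (Language β) => (s : Set (Language β)))
      (Finset.insert_erase h0)
    have h2 := congrArg (fun s : Finset (Language β) => (s : Set (Language β)))
      (Finset.insert_erase h1)
    simp only [Finset.coe_insert, Set.Finite.coe_toFinset] at this h2
    exact h2.symm.trans (by rw [← this, Set.insert_comm])

/-! ### The states of the stream -/

/-- The state that the word `w` leads to from the state `q`. -/
def run (n : ℕ) (w : List Letter) (q : ℕ) : ℕ :=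
  w.foldl (fun q x => act n x q) q

@[simp]
theorem run_nil (n q : ℕ) : run n [] q = q := rfl

@[simp]
theorem run_cons (n q : ℕ) (x : Letter) (w : List Letter) :
    run n (x :: w) q = run n w (act n x q) := rfl

theorem run_append (n q : ℕ) (u v : List Letter) : run n (u ++ v) q = run n v (run n u q) :=
  List.foldl_append

theorem run_lt {n : ℕ} (hn : 4 ≤ n) (w : List Letter) {q : ℕ} (hq : q < n) : run n w q < n := by
  induction w generalizing q with
  | nil => exact hq
  | cons x w ih => exact ih (act_lt hn x hq)

theorem act_dead {n : ℕ} (hn : 4 ≤ n) (x : Letter) : act n x (n - 1) = n - 1 := by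
  cases x <;> simp only [act] <;> split_ifs <;> omega

theorem act_final {n : ℕ} (hn : 4 ≤ n) (x : Letter) : act n x (n - 2) = n - 1 := by
  cases x <;> simp only [act] <;> split_ifs <;> omega

theorem run_dead {n : ℕ} (hn : 4 ≤ n) (w : List Letter) : run n w (n - 1) = n - 1 := by
  induction w with
  | nil => rfl
  | cons x w ih => rw [run_cons, act_dead hn, ih]

theorem run_final {n : ℕ} (hn : 4 ≤ n) {w : List Letter} (hw : w ≠ []) :
    run n w (n - 2) = n - 1 := by
  cases w with
  | nil => exact absurd rfl hw
  | cons x w => rw [run_cons, act_final hn, run_dead hn]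

theorem run_ge {n : ℕ} (hn : 4 ≤ n) {w : List Letter} (hw : w ≠ []) {q : ℕ} (h : n - 2 ≤ q)
    (hq : q < n) : run n w q = n - 1 := by
  obtain rfl | rfl : q = n - 2 ∨ q = n - 1 := by omega
  exacts [run_final hn hw, run_dead hn w]

theorem act_a {n q : ℕ} (hq : q < n - 2) : act n .a q = (q + 1) % (n - 2) := by
  simp only [act]
  split_ifs with h1 h2
  · rw [Nat.mod_eq_of_lt]; omega
  · rw [h2, show n - 3 + 1 = n - 2 by omega, Nat.mod_self]
  · omega

theorem run_replicate_a {n q : ℕ} (k : ℕ) (hq : q < n - 2) :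
    run n (List.replicate k .a) q = (q + k) % (n - 2) := by
  induction k generalizing q with
  | zero => simp [Nat.mod_eq_of_lt hq]
  | succ k ih =>
    rw [List.replicate_succ, run_cons, act_a hq, ih (Nat.mod_lt _ (by omega)), Nat.mod_add_mod]
    congr 1
    omega

theorem run_replicate_f {n q : ℕ} (hn : 4 ≤ n) (k : ℕ) (hq : q < n) :
    run n (List.replicate k .f) q = min (q + k) (n - 1) := by
  induction k generalizing q with
  | zero => simp; omega
  | succ k ih =>
    rw [List.replicate_succ, run_cons, ih (act_lt hn _ hq)]
    simp only [act]
    split_ifs <;> omega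

theorem run_replicate_fixed {n q : ℕ} {x : Letter} (k : ℕ) (h : act n x q = q) :
    run n (List.replicate k x) q = q := by
  induction k with
  | zero => rfl
  | succ k ih => rw [List.replicate_succ, run_cons, h, ih]

theorem act_g {n q : ℕ} (hq : q ≠ n - 2) : act n .g q = q := by
  simp [act, hq]

theorem act_e {n q : ℕ} (hq : q < n - 3) : act n .e q = q := by
  simp only [act]
  split_ifs <;> omega

theorem act_e_eq {n : ℕ} : act n .e (n - 3) = n - 2 := by
  simp [act]

/-- The language accepted from the state `q` when the letter `b` acts as `σ b`. -/
def stateLang {β : Type} (n : ℕ) (σ : β → Letter) (q : ℕ) : Language β :=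
  {w | run n (w.map σ) q = n - 2}

theorem mem_stateLang {β : Type} {n : ℕ} {σ : β → Letter} {q : ℕ} {w : List β} :
    w ∈ stateLang n σ q ↔ run n (w.map σ) q = n - 2 := Iff.rfl

theorem leftQuotient_stateLang {β : Type} (n : ℕ) (σ : β → Letter) (q : ℕ) (w : List β) :
    (stateLang n σ q).leftQuotient w = stateLang n σ (run n (w.map σ) q) := by
  ext x
  rw [Language.mem_leftQuotient, mem_stateLang, mem_stateLang, List.map_append, run_append]

theorem streamDFA_evalFrom {n : ℕ} (hn : 4 ≤ n) (w : List Letter) (q : Fin n) :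
    ((streamDFA n hn).evalFrom q w : ℕ) = run n w q := by
  induction w generalizing q with
  | nil => rfl
  | cons x w ih =>
    rw [DFA.evalFrom_cons, ih, run_cons]
    rfl

theorem mem_acceptsFrom_streamDFA {n : ℕ} (hn : 4 ≤ n) (w : List Letter) (q : Fin n) :
    w ∈ (streamDFA n hn).acceptsFrom q ↔ run n w q = n - 2 := by
  rw [DFA.mem_acceptsFrom, ← streamDFA_evalFrom hn]
  exact Fin.ext_iff

theorem mem_stream {n : ℕ} (hn : 4 ≤ n) (w : List Letter) :
    w ∈ stream n hn ↔ run n w 0 = n - 2 :=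
  mem_acceptsFrom_streamDFA hn w _

theorem stream_eq {n : ℕ} (hn : 4 ≤ n) : stream n hn = stateLang n id 0 := by
  ext w
  rw [mem_stream, mem_stateLang, List.map_id]

/-- Where it is defined, `π` is inverted by `σ`, so relabelling words by `π` is the same as pulling
back along `σ`. -/
theorem dialect_eq {n : ℕ} (hn : 4 ≤ n) {β : Type} (π : Letter → Option β) (σ : β → Letter)
    (h : ∀ x b, π x = some b ↔ x = σ b) : dialect π (stream n hn) = stateLang n σ 0 := by
  have key : ∀ (v : List Letter) (w : List β), v.map π = w.map some ↔ v = w.map σ := by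
    intro v
    induction v with
    | nil => intro w; cases w <;> simp
    | cons x v ih => intro w; cases w <;> simp [h, ih]
  ext w
  constructor
  · rintro ⟨v, hv, hvw⟩
    rw [key] at hvw
    subst hvw
    exact (mem_stream hn _).1 hv
  · intro hw
    exact ⟨w.map σ, (mem_stream hn _).2 hw, (key _ _).2 rfl⟩

/-- A word of `stateLang n σ q` for `q < n - 2` and no other state below `n - 2`. -/
def Separates {β : Type} (n : ℕ) (σ : β → Letter) (q : ℕ) (w : List β) : Prop :=
  ∀ p < n - 2, run n (w.map σ) p = n - 2 ↔ p = q

theorem stateLang_eq_one {β : Type} {n : ℕ} (hn : 4 ≤ n) (σ : β → Letter) :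
    stateLang n σ (n - 2) = 1 := by
  ext w
  rw [mem_stateLang, Language.mem_one]
  constructor
  · intro h
    by_contra hw
    rw [run_final hn (by simpa using hw)] at h
    omega
  · rintro rfl
    rfl

theorem stateLang_eq_zero {β : Type} {n : ℕ} (hn : 4 ≤ n) (σ : β → Letter) :
    stateLang n σ (n - 1) = 0 := by
  ext w
  rw [mem_stateLang, run_dead hn]
  simp only [Language.notMem_zero, iff_false]
  omega

theorem nil_mem_stateLang {β : Type} {n : ℕ} {σ : β → Letter} {q : ℕ} :
    [] ∈ stateLang n σ q ↔ q = n - 2 := Iff.rfl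

theorem prefixFree_stateLang {β : Type} {n : ℕ} (hn : 4 ≤ n) (σ : β → Letter) (q : ℕ) :
    PrefixFree (stateLang n σ q) := by
  rintro u hu _ hv ⟨t, rfl⟩
  rw [mem_stateLang] at hu hv
  rw [List.map_append, run_append, hu] at hv
  by_contra ht
  rw [run_final hn (by simpa using ht)] at hv
  omega

/-- The empty word singles out `n - 2`, the separating words single out the states below it, and
only `n - 1` has the empty language. The family `f` is left abstract so as to cover both the state
languages and their products with a star. -/
theorem injOn_of_separates {β : Type} {n : ℕ} {f : ℕ → Language β}
    (hnil : ∀ q < n, [] ∈ f q ↔ q = n - 2) (hdead : f (n - 1) = 0)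
    (hsep : ∀ q < n - 2, ∃ w : List β, ∀ p < n - 2, w ∈ f p ↔ p = q) :
    Set.InjOn f (Set.Iio n) := by
  have key : ∀ p < n, ∀ q < n, p < q → f p ≠ f q := by
    intro p hp q hq hpq heq
    obtain rfl | hq1 := eq_or_ne q (n - 1)
    · rw [hdead] at heq
      by_cases hp2 : p < n - 2
      · obtain ⟨w, hw⟩ := hsep p hp2
        have := (hw p hp2).2 rfl
        rw [heq] at this
        exact Language.notMem_zero _ this
      · have := (hnil p hp).2 (by omega)
        rw [heq] at this
        exact Language.notMem_zero _ this
    · by_cases hq2 : q < n - 2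
      · obtain ⟨w, hw⟩ := hsep p (by omega)
        have := (hw p (by omega)).2 rfl
        rw [heq] at this
        exact hpq.ne' ((hw q hq2).1 this)
      · have := (hnil q hq).2 (by omega)
        rw [← heq, hnil p hp] at this
        omega
  intro p hp q hq heq
  rcases lt_trichotomy p q with h | h | h
  · exact absurd heq (key p hp q hq h)
  · exact h
  · exact absurd heq.symm (key q hq p hp h)

theorem stateLang_injOn {β : Type} {n : ℕ} (hn : 4 ≤ n) (σ : β → Letter)
    (hsep : ∀ q < n - 2, ∃ w : List β, Separates n σ q w) :
    Set.InjOn (stateLang n σ) (Set.Iio n) :=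
  injOn_of_separates (fun _ _ => nil_mem_stateLang) (stateLang_eq_zero hn σ) hsep

theorem exists_run_eq {β : Type} {n : ℕ} (hn : 4 ≤ n) (σ : β → Letter) (b : β)
    (hreach : ∀ q < n - 2, ∃ w : List β, run n (w.map σ) 0 = q)
    (hsep : ∀ q < n - 2, ∃ w : List β, Separates n σ q w) {q : ℕ} (hq : q < n) :
    ∃ w : List β, run n (w.map σ) 0 = q := by
  by_cases h : q < n - 2
  · exact hreach q h
  -- A word separating the initial state leads from it to the final state; any further letter leads
  -- to the dead state.
  obtain ⟨w, hw⟩ := hsep 0 (by omega)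
  have hw := (hw 0 (by omega)).2 rfl
  obtain rfl | rfl : q = n - 2 ∨ q = n - 1 := by omega
  · exact ⟨w, hw⟩
  · exact ⟨w ++ [b], by rw [List.map_append, run_append, hw, run_final hn (by simp)]⟩

theorem κ_stateLang {β : Type} {n : ℕ} (hn : 4 ≤ n) (σ : β → Letter) (q : ℕ) (hq : q < n)
    (hreach : ∀ p < n, ∃ w : List β, run n (w.map σ) q = p)
    (hsep : ∀ q < n - 2, ∃ w : List β, Separates n σ q w) : κ (stateLang n σ q) = n := by
  classical
  refine le_antisymm ?_ ?_
  · refine (κ_le_of_range_subset ((Finset.range n).image (stateLang n σ)) fun w => ?_).trans ?_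
    · rw [leftQuotient_stateLang]
      exact Finset.mem_image_of_mem _ (Finset.mem_range.2 (run_lt hn _ hq))
    · exact_mod_cast Finset.card_image_le.trans (Finset.card_range n).le
  · have := le_κ_of_injOn (L := stateLang n σ q) (Finset.range n) (stateLang n σ)
      (by simpa using stateLang_injOn hn σ hsep) fun p hp => ?_
    · simpa using this
    · obtain ⟨w, hw⟩ := hreach p (Finset.mem_range.1 hp)
      exact ⟨w, by rw [leftQuotient_stateLang, hw]⟩

theorem isPrefixFreeOf_stateLang {β : Type} {n : ℕ} (hn : 4 ≤ n) (σ : β → Letter) (b : β)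
    (hreach : ∀ q < n - 2, ∃ w : List β, run n (w.map σ) 0 = q)
    (hsep : ∀ q < n - 2, ∃ w : List β, Separates n σ q w) :
    IsPrefixFreeOf n (stateLang n σ 0) :=
  ⟨prefixFree_stateLang hn σ 0, κ_stateLang hn σ 0 (by omega)
    (fun _ hp => exists_run_eq hn σ b hreach hsep hp) hsep⟩

theorem reach_of_a {β : Type} {n : ℕ} {σ : β → Letter} {b : β} (hb : σ b = .a) :
    ∀ q < n - 2, ∃ w : List β, run n (w.map σ) 0 = q := fun q hq =>
  ⟨List.replicate q b, by
    rw [List.map_replicate, hb, run_replicate_a q (by omega), zero_add, Nat.mod_eq_of_lt hq]⟩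

theorem reach_of_f {β : Type} {n : ℕ} (hn : 4 ≤ n) {σ : β → Letter} {b : β} (hb : σ b = .f) :
    ∀ q < n - 2, ∃ w : List β, run n (w.map σ) 0 = q := fun q hq =>
  ⟨List.replicate q b, by
    rw [List.map_replicate, hb, run_replicate_f hn q (by omega)]
    omega⟩

theorem sep_of_f {β : Type} {n : ℕ} (hn : 4 ≤ n) {σ : β → Letter} {b : β} (hb : σ b = .f) :
    ∀ q < n - 2, ∃ w : List β, Separates n σ q w := fun q hq =>
  ⟨List.replicate (n - 2 - q) b, fun p hp => by
    rw [List.map_replicate, hb, run_replicate_f hn _ (by omega)]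
    omega⟩

/-- Rotation by `r - q` modulo `k` is a bijection that takes `q` to `r`; the extra `k` keeps the
natural subtraction from truncating. -/
theorem add_mod_eq_iff {k p q r : ℕ} (hp : p < k) (hq : q < k) (hr : r < k) :
    (p + (k + r - q)) % k = r ↔ p = q := by
  rcases lt_or_ge (p + (k + r - q)) k with h | h
  · rw [Nat.mod_eq_of_lt h]; omega
  · rcases lt_or_ge (p + (k + r - q) - k) k with h' | h'
    · rw [Nat.mod_eq_sub_mod h, Nat.mod_eq_of_lt h']; omega
    · rw [Nat.mod_eq_sub_mod h, Nat.mod_eq_sub_mod h', Nat.mod_eq_of_lt (by omega)]; omega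

/-- If `a` and a letter that sends exactly one state `r < n - 2` to the final state are present, then
all states can be separated. -/
theorem sep_of_a {β : Type} {n r : ℕ} (hr : r < n - 2) {σ : β → Letter} {b c : β}
    (hb : σ b = .a) (hc : ∀ p < n - 2, act n (σ c) p = n - 2 ↔ p = r) :
    ∀ q < n - 2, ∃ w : List β, Separates n σ q w := fun q hq =>
  ⟨List.replicate (n - 2 + r - q) b ++ [c], fun p hp => by
    rw [List.map_append, run_append, List.map_replicate, hb, run_replicate_a _ hp]
    simp only [List.map_cons, List.map_nil, run_cons, run_nil]
    rw [hc _ (Nat.mod_lt _ (by omega)), add_mod_eq_iff hp hq hr]⟩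

theorem act_e_eq_final_iff {n : ℕ} (hn : 4 ≤ n) :
    ∀ p < n - 2, act n .e p = n - 2 ↔ p = n - 3 := fun p hp => by
  simp only [act]
  split_ifs <;> omega

theorem act_d_eq_final_iff {n : ℕ} (hn : 4 ≤ n) :
    ∀ p < n - 2, act n .d p = n - 2 ↔ p = 0 := fun p hp => by
  simp only [act]
  split_ifs <;> omega

theorem isMinimal_streamDFA {n : ℕ} (hn : 4 ≤ n) : IsMinimal (streamDFA n hn) := by
  have hsep := sep_of_f hn (σ := id) (b := .f) rfl
  constructor
  · intro q
    obtain ⟨w, hw⟩ := exists_run_eq hn id .f (reach_of_f hn rfl) hsep q.isLt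
    refine ⟨w, Fin.ext ?_⟩
    rw [DFA.eval, streamDFA_evalFrom, ← hw, List.map_id]
    rfl
  · intro p q h
    refine Fin.ext (stateLang_injOn hn id hsep p.isLt q.isLt ?_)
    ext w
    rw [mem_stateLang, mem_stateLang, List.map_id, ← mem_acceptsFrom_streamDFA hn, h,
      mem_acceptsFrom_streamDFA]

theorem isPrefixFreeOf_stream {n : ℕ} (hn : 4 ≤ n) : IsPrefixFreeOf n (stream n hn) := by
  rw [stream_eq]
  exact isPrefixFreeOf_stateLang hn id .f (reach_of_f hn rfl) (sep_of_f hn (b := .f) rfl)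

/-! ### Alphabets with at most one letter -/

theorem list_eq_of_length_eq {β : Type} [Subsingleton β] {u v : List β}
    (h : u.length = v.length) : u = v :=
  List.ext_getElem h fun _ _ _ => Subsingleton.elim _ _

/-- Over at most one letter a quotient depends only on the length of the word, and all lengths above
`N` give the empty quotient, represented by `N + 1`. -/
theorem κ_le_of_length_le {β : Type} [Subsingleton β] {L : Language β} {N : ℕ}
    (h : ∀ w ∈ L, w.length ≤ N) : κ L ≤ (N + 2 : ℕ) := by
  classical
  let K : ℕ → Language β := fun i => {y | ∃ x ∈ L, x.length = i + y.length}
  refine (κ_le_of_range_subset ((Finset.range (N + 2)).image K) fun w => ?_).trans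
    (by exact_mod_cast Finset.card_image_le.trans (Finset.card_range _).le)
  refine Finset.mem_image.2 ⟨min w.length (N + 1), Finset.mem_range.2 (by omega), ?_⟩
  ext y
  rw [Language.mem_leftQuotient]
  constructor
  · rintro ⟨x, hx, hxy⟩
    have := h x hx
    rwa [← list_eq_of_length_eq (u := x) (v := w ++ y)
      (by rw [List.length_append]; omega)]
  · intro hy
    have := h _ hy
    rw [List.length_append] at this
    exact ⟨_, hy, by rw [List.length_append]; omega⟩

theorem κ_of_mem_iff_length {β : Type} [Subsingleton β] [Nonempty β] {L : Language β} {k : ℕ}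
    (h : ∀ w, w ∈ L ↔ w.length = k) : κ L = (k + 2 : ℕ) := by
  refine le_antisymm (κ_le_of_length_le fun w hw => ((h w).1 hw).le) ?_
  obtain ⟨b⟩ := ‹Nonempty β›
  have key : ∀ i j, i < j → i < k + 2 → j < k + 2 →
      L.leftQuotient (List.replicate i b) ≠ L.leftQuotient (List.replicate j b) := by
    intro i j hij hi hj heq
    have : List.replicate (k - i) b ∈ L.leftQuotient (List.replicate i b) := by
      rw [Language.mem_leftQuotient, h]
      simp
      omega
    rw [heq, Language.mem_leftQuotient, h] at this
    simp at this
    omega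
  have := le_κ_of_injOn (Finset.range (k + 2)) (fun i => L.leftQuotient (List.replicate i b))
    (fun i hi j hj heq => ?_) fun i _ => ⟨_, rfl⟩
  · simpa using this
  · rw [Finset.mem_coe, Finset.mem_range] at hi hj
    rcases lt_trichotomy i j with hij | hij | hij
    · exact absurd heq (key i j hij hi hj)
    · exact hij
    · exact absurd heq.symm (key j i hij hj hi)

theorem IsPrefixFreeOf.nonempty {β : Type} {n : ℕ} {L : Language β} (hn : 4 ≤ n)
    (h : IsPrefixFreeOf n L) : ∃ w, w ∈ L := by
  obtain ⟨P, -, -, -, hP⟩ := h.exists_finset hn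
  obtain ⟨w, hw⟩ : (1 : Language β) ∈ Set.range L.leftQuotient := by simp [hP]
  have : [] ∈ L.leftQuotient w := hw ▸ Language.nil_mem_one
  exact ⟨w, by simpa using this⟩

theorem IsPrefixFreeOf.nonempty_alphabet {β : Type} {n : ℕ} {L : Language β} (hn : 4 ≤ n)
    (h : IsPrefixFreeOf n L) : Nonempty β := by
  by_contra hcon
  rw [not_nonempty_iff] at hcon
  have := κ_le_of_length_le (L := L) (N := 0) fun w _ => by simp [Subsingleton.elim w []]
  rw [h.2] at this
  norm_cast at this
  omega

/-- Any two words over one letter are comparable as prefixes, so the language is a single word; its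
length is then forced by the complexity. -/
theorem IsPrefixFreeOf.mem_iff_length {β : Type} [Subsingleton β] {n : ℕ} {L : Language β}
    (hn : 4 ≤ n) (h : IsPrefixFreeOf n L) (w : List β) : w ∈ L ↔ w.length = n - 2 := by
  have := h.nonempty_alphabet hn
  obtain ⟨v, hv⟩ := h.nonempty hn
  have key : ∀ w, w ∈ L ↔ w.length = v.length := fun w => by
    constructor
    · intro hw
      rcases le_total w.length v.length with hl | hl
      · rw [h.1 w hw v hv]
        rw [List.prefix_iff_eq_take]
        exact list_eq_of_length_eq (by simp [hl])
      · rw [h.1 v hv w hw]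
        rw [List.prefix_iff_eq_take]
        exact list_eq_of_length_eq (by simp [hl])
    · intro hl
      rwa [list_eq_of_length_eq hl]
  have hκ := h.2
  rw [κ_of_mem_iff_length key] at hκ
  norm_cast at hκ
  rw [key, ← hκ]
  simp

theorem two_le_card_of_not_subsingleton {β : Type} [Finite β] (h : ¬ Subsingleton β) :
    2 ≤ Nat.card β := by
  by_contra hcon
  exact h (Finite.card_le_one_iff_subsingleton.1 (by omega))

/-- Over one letter the operands have words of lengths `m - 2` and `n - 2` only. An operation that
stays inside their union has complexity at most `max m n`. -/
theorem needsLetters₂_two {op : (α : Type) → Language α → Language α → Language α} {m n B : ℕ}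
    (hm : 4 ≤ m) (hn : 4 ≤ n) (hop : ∀ α L' L, ∀ w ∈ op α L' L, w ∈ L' ∨ w ∈ L)
    (hB : max m n < B) : NeedsLetters₂ op m n B 2 := by
  intro β _ L' L h' h hκ
  refine two_le_card_of_not_subsingleton fun _ => ?_
  have := κ_le_of_length_le (L := op β L' L) (N := max m n - 2) fun w hw => by
    rcases hop _ _ _ w hw with hw | hw
    · rw [h'.mem_iff_length hm] at hw
      omega
    · rw [h.mem_iff_length hn] at hw
      omega
  rw [hκ] at this
  norm_cast at this
  omega

/-! ### Quotients -/

theorem κ_zero {β : Type} : κ (0 : Language β) = 1 := by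
  have : Set.range (0 : Language β).leftQuotient = {0} := by
    ext K
    simp [leftQuotient_zero, eq_comm]
  rw [κ, this, Set.encard_singleton]

theorem zero_ne_one_language {β : Type} : (0 : Language β) ≠ 1 := fun h => by
  have : [] ∈ (1 : Language β) := Language.nil_mem_one
  rw [← h] at this
  exact Language.notMem_zero _ this

theorem range_leftQuotient_one_subset {β : Type} :
    Set.range (1 : Language β).leftQuotient ⊆ {0, 1} := by
  rintro _ ⟨w, rfl⟩
  cases w with
  | nil => simp
  | cons b w => simp [leftQuotient_one_cons]

theorem κ_one_le {β : Type} : κ (1 : Language β) ≤ 2 :=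
  (Set.encard_le_encard range_leftQuotient_one_subset).trans
    (Set.encard_pair zero_ne_one_language).le

theorem κ_one {β : Type} [Nonempty β] : κ (1 : Language β) = 2 := by
  obtain ⟨b⟩ := ‹Nonempty β›
  rw [κ, ← Set.encard_pair (zero_ne_one_language (β := β))]
  congr 1
  refine range_leftQuotient_one_subset.antisymm ?_
  rintro _ (rfl | rfl)
  · exact ⟨[b], leftQuotient_one_cons b []⟩
  · exact ⟨[], rfl⟩

theorem κ_leftQuotient_le {β : Type} (L : Language β) (w : List β) :
    κ (L.leftQuotient w) ≤ κ L := by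
  refine Set.encard_le_encard ?_
  rintro _ ⟨v, rfl⟩
  exact exists_leftQuotient_leftQuotient ⟨w, rfl⟩ v

theorem IsPrefixFreeOf.quotientsBounded {β : Type} {n : ℕ} {L : Language β}
    (h : IsPrefixFreeOf n L) : QuotientsBounded n L := fun w =>
  ⟨fun hw => hw ▸ κ_one_le, fun hw => hw ▸ κ_zero.le, (κ_leftQuotient_le L w).trans h.2.le⟩

theorem quotientsMeet_stateLang {β : Type} {n : ℕ} (hn : 4 ≤ n) {σ : β → Letter} {b c : β}
    (hb : σ b = .a) (hc : σ c = .f) : QuotientsMeet n (stateLang n σ 0) := by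
  have hsep := sep_of_f hn hc
  have hreach : ∀ q < n, ∃ w : List β, run n (w.map σ) 0 = q :=
    fun q hq => exists_run_eq hn σ b (reach_of_a hb) hsep hq
  have : Nonempty β := ⟨b⟩
  refine ⟨?_, ?_, fun w => ⟨fun hw => hw ▸ κ_one, fun hw => hw ▸ κ_zero, ?_⟩⟩
  · obtain ⟨w, hw⟩ := hreach (n - 2) (by omega)
    exact ⟨w, by rw [leftQuotient_stateLang, hw, stateLang_eq_one hn]⟩
  · obtain ⟨w, hw⟩ := hreach (n - 1) (by omega)
    exact ⟨w, by rw [leftQuotient_stateLang, hw, stateLang_eq_zero hn]⟩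
  · rw [leftQuotient_stateLang]
    have hlt : run n (w.map σ) 0 < n := run_lt hn _ (by omega)
    generalize run n (w.map σ) 0 = q at hlt
    intro h1 h0
    have hq : q < n - 2 := by
      by_contra hq
      obtain rfl | rfl : q = n - 2 ∨ q = n - 1 := by omega
      · exact h1 (stateLang_eq_one hn σ)
      · exact h0 (stateLang_eq_zero hn σ)
    refine κ_stateLang hn σ q hlt (fun p hp => ?_) hsep
    obtain ⟨w, hw⟩ := hreach p hp
    -- The cycle first brings `q` back to the initial state, from which every state can be reached.
    refine ⟨List.replicate (n - 2 - q) b ++ w, ?_⟩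
    rw [List.map_append, run_append, List.map_replicate, hb, run_replicate_a _ hq,
      Nat.add_sub_cancel' hq.le, Nat.mod_self, hw]

/-- Over one letter the quotient by a letter is the single word of length `n - 3 > 0`. It is neither
`{ε}` nor `∅`, yet has complexity `n - 1`. -/
theorem QuotientsMeet.two_le_card {β : Type} [Finite β] {n : ℕ} {L : Language β} (hn : 4 ≤ n)
    (h : IsPrefixFreeOf n L) (hL : QuotientsMeet n L) : 2 ≤ Nat.card β := by
  refine two_le_card_of_not_subsingleton fun _ => ?_
  have := h.nonempty_alphabet hn
  obtain ⟨b⟩ := this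
  have hmem : ∀ w, w ∈ L.leftQuotient [b] ↔ w.length = n - 3 := fun w => by
    rw [Language.mem_leftQuotient, h.mem_iff_length hn, List.length_append, List.length_singleton]
    omega
  have hκ := (hL.2.2 [b]).2.2 (fun h1 => ?_) fun h0 => ?_
  · have : Nonempty β := ⟨b⟩
    rw [κ_of_mem_iff_length hmem] at hκ
    norm_cast at hκ
    omega
  · have : [] ∈ L.leftQuotient [b] := h1 ▸ Language.nil_mem_one
    rw [hmem, List.length_nil] at this
    omega
  · have : List.replicate (n - 3) b ∈ L.leftQuotient [b] := by simp [hmem]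
    rw [h0] at this
    exact Language.notMem_zero _ this

/-! ### Product -/

/-- Since `ε ∉ K`, the first letter must be read by the factor from `K`. -/
theorem leftQuotient_mul_singleton {β : Type} {K : Language β} (L : Language β) (hK : [] ∉ K)
    (b : β) : (K * L).leftQuotient [b] = K.leftQuotient [b] * L := by
  ext w
  rw [Language.mem_leftQuotient, Language.mem_mul, Language.mem_mul]
  constructor
  · rintro ⟨u, hu, v, hv, h⟩
    cases u with
    | nil => exact absurd hu hK
    | cons c u =>
      simp only [List.cons_append, List.nil_append, List.cons.injEq] at h
      obtain ⟨rfl, h⟩ := h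
      exact ⟨u, hu, v, hv, h⟩
  · rintro ⟨u, hu, v, hv, rfl⟩
    exact ⟨b :: u, hu, v, hv, rfl⟩

theorem leftQuotient_cons {β : Type} (L : Language β) (b : β) (w : List β) :
    L.leftQuotient (b :: w) = (L.leftQuotient [b]).leftQuotient w :=
  Language.leftQuotient_append L [b] w

theorem κ_mul_le {β : Type} {m n : ℕ} (hm : 4 ≤ m) (hn : 4 ≤ n) {L' L : Language β}
    (h' : IsPrefixFreeOf m L') (h : IsPrefixFreeOf n L) : κ (L' * L) ≤ (m + n - 2 : ℕ) := by
  classical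
  obtain ⟨P', hcard', -, -, hP'⟩ := h'.exists_finset hm
  obtain ⟨P, hcard, -, -, hP⟩ := h.exists_finset hn
  -- These are `m - 2` products with the first factor still unfinished, and `n` quotients of `L`.
  let T := P'.image (· * L) ∪ insert 0 (insert 1 P)
  have hT : ∀ K ∈ Set.range L.leftQuotient, K ∈ T := fun K hK => by
    rw [hP] at hK
    refine Finset.mem_union_right _ ?_
    simpa using hK
  have key : ∀ w, ∀ K ∈ Set.range L'.leftQuotient, (K * L).leftQuotient w ∈ T := by
    intro w
    induction w with
    | nil =>
      intro K hK
      rw [hP'] at hK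
      rcases hK with rfl | rfl | hK
      · rw [zero_mul]
        exact hT _ (by simp [hP])
      · rw [one_mul]
        exact hT _ ⟨[], rfl⟩
      · exact Finset.mem_union_left _ (Finset.mem_image_of_mem _ hK)
    | cons b w ih =>
      intro K hK
      -- By prefix-freeness `ε ∈ K` forces `K = {ε}`: the first factor is complete and only `L`
      -- remains.
      by_cases hnil : [] ∈ K
      · rw [h'.1.eq_one hK hnil, one_mul]
        exact hT _ ⟨_, rfl⟩
      · rw [leftQuotient_cons, leftQuotient_mul_singleton L hnil]
        exact ih _ (exists_leftQuotient_leftQuotient hK _)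
  refine (κ_le_of_range_subset T fun w => key w L' ⟨[], rfl⟩).trans ?_
  have h1 := Finset.card_union_le (P'.image (· * L)) (insert 0 (insert 1 P))
  have h2 : (P'.image (· * L)).card ≤ P'.card := Finset.card_image_le
  have h3 := Finset.card_insert_le 0 (insert 1 P)
  have h4 := Finset.card_insert_le 1 P
  norm_cast
  change (P'.image (· * L) ∪ insert 0 (insert 1 P)).card ≤ _
  omega

theorem mem_stateLang_f_iff {n : ℕ} (hn : 4 ≤ n) {β : Type} (w : List β) :
    w ∈ stateLang n (fun _ => .f) 0 ↔ w.length = n - 2 := by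
  rw [mem_stateLang, List.map_const', run_replicate_f hn _ (by omega)]
  omega

theorem κ_mul_stateLang_f {β : Type} [Subsingleton β] [Nonempty β] {m n : ℕ} (hm : 4 ≤ m)
    (hn : 4 ≤ n) : κ ((stateLang m (fun _ : β => .f) 0 : Language β) *
      stateLang n (fun _ : β => .f) 0) = (m + n - 2 : ℕ) := by
  rw [κ_of_mem_iff_length (k := m + n - 4) fun w => ?_]
  · congr 1
    omega
  · rw [Language.mem_mul]
    simp only [mem_stateLang_f_iff hm, mem_stateLang_f_iff hn]
    constructor
    · rintro ⟨u, hu, v, hv, rfl⟩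
      rw [List.length_append]
      omega
    · intro hw
      exact ⟨w.take (m - 2), by simp; omega, w.drop (m - 2), by simp; omega,
        List.take_append_drop _ _⟩

theorem needsLetters₂_mul {m n : ℕ} (hm : 4 ≤ m) :
    NeedsLetters₂ (fun _ L' L => L' * L) m n (m + n - 2) 1 := by
  intro β _ L' L h' _ _
  have := h'.nonempty_alphabet hm
  exact Nat.card_pos

/-! ### Star -/

theorem leftQuotient_kstar_singleton {β : Type} (L : Language β) (b : β) :
    (L∗).leftQuotient [b] = L.leftQuotient [b] * L∗ := by
  ext w
  rw [Language.mem_leftQuotient, Language.mem_mul]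
  constructor
  · intro h
    obtain ⟨S, hS, hmem⟩ := Language.mem_kstar_iff_exists_nonempty.1 h
    cases S with
    | nil => simp at hS
    | cons u S =>
      obtain ⟨hu, hne⟩ := hmem u (by simp)
      cases u with
      | nil => exact absurd rfl hne
      | cons c u =>
        simp only [List.cons_append, List.nil_append, List.flatten_cons, List.cons.injEq] at hS
        obtain ⟨rfl, rfl⟩ := hS
        exact ⟨u, hu, S.flatten, Language.join_mem_kstar fun y hy => (hmem y (by simp [hy])).1, rfl⟩
  · rintro ⟨u, hu, v, hv, rfl⟩
    obtain ⟨S, rfl, hS⟩ := Language.mem_kstar.1 hv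
    refine Language.mem_kstar.2 ⟨(b :: u) :: S, by simp, ?_⟩
    intro y hy
    rcases List.mem_cons.1 hy with rfl | hy
    · exact hu
    · exact hS y hy

theorem κ_kstar_le {β : Type} {n : ℕ} (hn : 4 ≤ n) {L : Language β} (h : IsPrefixFreeOf n L) :
    κ (L∗) ≤ n := by
  classical
  obtain ⟨P, hcard, -, -, hP⟩ := h.exists_finset hn
  have hQ : ∀ K, K ∈ Set.range L.leftQuotient ↔ K ∈ insert 0 (insert 1 P) := fun K => by
    rw [hP]
    simp
  have key : ∀ w, ∀ K ∈ Set.range L.leftQuotient,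
      (K * L∗).leftQuotient w ∈ (insert 0 (insert 1 P)).image (· * L∗) := by
    intro w
    induction w with
    | nil =>
      intro K hK
      exact Finset.mem_image_of_mem _ ((hQ K).1 hK)
    | cons b w ih =>
      intro K hK
      rw [leftQuotient_cons]
      by_cases hnil : [] ∈ K
      -- At `{ε}` the remaining language is `L∗`, and reading a letter starts a new factor from `L`.
      -- So the quotients of the star all have the form `K * L∗`.
      · rw [h.1.eq_one hK hnil, one_mul, leftQuotient_kstar_singleton]
        exact ih _ ⟨_, rfl⟩
      · rw [leftQuotient_mul_singleton _ hnil]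
        exact ih _ (exists_leftQuotient_leftQuotient hK _)
  refine (κ_le_of_range_subset _ fun w => one_mul (L∗) ▸ key w 1 (by simp [hP])).trans ?_
  have h2 : ((insert 0 (insert 1 P)).image (· * L∗)).card ≤ _ := Finset.card_image_le
  have h3 := Finset.card_insert_le 0 (insert 1 P)
  have h4 := Finset.card_insert_le 1 P
  norm_cast
  omega

theorem leftQuotient_stateLang_mul {β : Type} {n q : ℕ} (σ : β → Letter) (M : Language β)
    (hq : q ≠ n - 2) (b : β) :
    (stateLang n σ q * M).leftQuotient [b] = stateLang n σ (act n (σ b) q) * M := by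
  rw [leftQuotient_mul_singleton M (by rwa [nil_mem_stateLang]), leftQuotient_stateLang]
  rfl

theorem leftQuotient_stateLang_mul_replicate {β : Type} {n q : ℕ} {σ : β → Letter}
    (M : Language β) {b : β} (hb : σ b = .a) (hq : q < n - 2) (k : ℕ) :
    (stateLang n σ q * M).leftQuotient (List.replicate k b) =
      stateLang n σ ((q + k) % (n - 2)) * M := by
  induction k generalizing q with
  | zero => rw [add_zero, Nat.mod_eq_of_lt hq]; rfl
  | succ k ih =>
    rw [List.replicate_succ, leftQuotient_cons, leftQuotient_stateLang_mul σ M hq.ne, hb,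
      act_a hq, ih (Nat.mod_lt _ (by omega)), Nat.mod_add_mod, add_assoc, add_comm 1 k]

theorem κ_kstar_stateLang {β : Type} {n : ℕ} (hn : 4 ≤ n) {σ : β → Letter} {b c : β}
    (hb : σ b = .a) (hc : σ c = .d) : κ ((stateLang n σ 0)∗) = n := by
  refine le_antisymm (κ_kstar_le hn (isPrefixFreeOf_stateLang hn σ b (reach_of_a hb)
    (sep_of_a (r := 0) (by omega) hb fun p hp => by rw [hc, act_d_eq_final_iff hn p hp]))) ?_
  set S := (stateLang n σ 0)∗ with hS
  have hnilS : [] ∈ S := Language.nil_mem_kstar _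
  have hnil : ∀ q < n, [] ∈ stateLang n σ q * S ↔ q = n - 2 := by
    intro q _
    rw [Language.mem_mul, ← nil_mem_stateLang (σ := σ)]
    constructor
    · rintro ⟨u, hu, v, -, h⟩
      rwa [← (List.append_eq_nil_iff.1 h).1]
    · exact fun h => ⟨[], h, [], hnilS, rfl⟩
  have hinj : Set.InjOn (fun q => stateLang n σ q * S) (Set.Iio n) := by
    refine injOn_of_separates hnil (by rw [stateLang_eq_zero hn, zero_mul]) fun q hq => ?_
    -- The cycle turns `q` to `0`, the only state below `n - 2` that `d` makes final. The cycle
    -- avoids the final state, so no restart of the star interferes.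
    refine ⟨List.replicate (n - 2 - q) b ++ [c], fun p hp => ?_⟩
    rw [← Language.mem_leftQuotient, leftQuotient_stateLang_mul_replicate S hb hp,
      ← List.append_nil [c], ← Language.mem_leftQuotient,
      leftQuotient_stateLang_mul σ S (Nat.mod_lt _ (by omega)).ne, hnil _ (act_lt hn _
        ((Nat.mod_lt _ (by omega)).trans (by omega))), hc,
      act_d_eq_final_iff hn _ (Nat.mod_lt _ (by omega)), show n - 2 - q = n - 2 + 0 - q by omega,
      add_mod_eq_iff hp hq (by omega)]
  have hone : S.leftQuotient [b] = stateLang n σ 1 * S := by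
    rw [hS, leftQuotient_kstar_singleton, leftQuotient_stateLang]
    simp [hb, act_a (n := n) (q := 0) (by omega), Nat.mod_eq_of_lt (show 1 < n - 2 by omega)]
  have hlow : ∀ q < n - 2, ∃ w, S.leftQuotient w = stateLang n σ q * S := by
    intro q hq
    -- The total is a full turn plus `q`: `S` itself plays the role of the state `n - 2`, so
    -- `stateLang n σ 0 * S` is only reached by going round the cycle.
    refine ⟨b :: List.replicate (n - 2 + q - 1) b, ?_⟩
    rw [leftQuotient_cons, hone, leftQuotient_stateLang_mul_replicate S hb (by omega),
      show 1 + (n - 2 + q - 1) = n - 2 + q by omega, Nat.add_mod_left, Nat.mod_eq_of_lt hq]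
  have := le_κ_of_injOn (L := S) (Finset.range n) _ (by simpa using hinj) fun q hq => ?_
  · simpa using this
  · by_cases hq2 : q < n - 2
    · exact hlow q hq2
    · rw [Finset.mem_range] at hq
      obtain rfl | rfl : q = n - 2 ∨ q = n - 1 := by omega
      · exact ⟨[], by rw [stateLang_eq_one hn, one_mul]; rfl⟩
      -- In the star the final state restarts, so `∅` has to be reached directly from a non-final
      -- state; the letter `d` does this from `1`.
      · refine ⟨[b] ++ [c], ?_⟩
        rw [Language.leftQuotient_append, hone, leftQuotient_stateLang_mul σ S (by omega), hc]
        simp [act]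

theorem needsLetters₁_kstar {n : ℕ} (hn : 4 ≤ n) : NeedsLetters₁ (fun _ L => κ (L∗)) n n 2 := by
  classical
  intro β _ L h hκ
  refine two_le_card_of_not_subsingleton fun _ => ?_
  obtain ⟨v, hv⟩ := h.nonempty hn
  -- Over one letter the star consists of the multiples of `n - 2`, and its quotients are given by
  -- residues: at most `n - 2` of them.
  have hmem : ∀ w, w ∈ L∗ ↔ n - 2 ∣ w.length := by
    intro w
    rw [Language.mem_kstar]
    constructor
    · rintro ⟨S, rfl, hS⟩
      rw [List.length_flatten]
      refine List.dvd_sum fun x hx => ?_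
      obtain ⟨y, hy, rfl⟩ := List.mem_map.1 hx
      rw [(h.mem_iff_length hn y).1 (hS y hy)]
    · rintro ⟨k, hk⟩
      refine ⟨List.replicate k v, list_eq_of_length_eq ?_, ?_⟩
      · rw [hk, List.length_flatten, List.map_replicate, (h.mem_iff_length hn v).1 hv]
        simp [mul_comm]
      · intro y hy
        rwa [List.eq_of_mem_replicate hy]
  have hle := κ_le_of_range_subset (L := L∗) ((Finset.range (n - 2)).image fun i =>
    ({y | n - 2 ∣ i + y.length} : Set (List β))) fun w => by
      refine Finset.mem_image.2 ⟨w.length % (n - 2), Finset.mem_range.2 (Nat.mod_lt _ (by omega)), ?_⟩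
      ext y
      rw [Language.mem_leftQuotient, hmem, List.length_append]
      change n - 2 ∣ _ ↔ _
      rw [Nat.dvd_iff_mod_eq_zero, Nat.dvd_iff_mod_eq_zero, Nat.mod_add_mod]
  have hle2 := hle.trans (Nat.cast_le.2 (Finset.card_image_le.trans (Finset.card_range _).le))
  dsimp only at hκ
  rw [hκ] at hle2
  norm_cast at hle2
  omega

/-! ### Boolean operations -/

section Boolean

variable {β : Type}

theorem leftQuotient_sup (K L : Language β) (w : List β) :
    (K ⊔ L).leftQuotient w = K.leftQuotient w ⊔ L.leftQuotient w := rfl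

theorem leftQuotient_inf (K L : Language β) (w : List β) :
    (K ⊓ L).leftQuotient w = K.leftQuotient w ⊓ L.leftQuotient w := rfl

theorem leftQuotient_sdiff (K L : Language β) (w : List β) :
    (K \ L).leftQuotient w = K.leftQuotient w \ L.leftQuotient w := rfl

theorem leftQuotient_symmDiff (K L : Language β) (w : List β) :
    (K ∆ L).leftQuotient w = K.leftQuotient w ∆ L.leftQuotient w := rfl

theorem zero_eq_bot_language : (0 : Language β) = ⊥ := rfl

theorem mem_sdiff_language {K L : Language β} {w : List β} : w ∈ K \ L ↔ w ∈ K ∧ w ∉ L := Iff.rfl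

theorem mem_sup_language {K L : Language β} {w : List β} : w ∈ K ⊔ L ↔ w ∈ K ∨ w ∈ L := Iff.rfl

theorem mem_symmDiff_language {K L : Language β} {w : List β} :
    w ∈ K ∆ L ↔ (w ∈ K ∧ w ∉ L) ∨ (w ∈ L ∧ w ∉ K) := Iff.rfl

theorem one_inf_of_nil_notMem {K : Language β} (h : [] ∉ K) : 1 ⊓ K = 0 := by
  ext w
  rw [Language.mem_inf, Language.mem_one]
  simp only [Language.notMem_zero, iff_false, not_and]
  rintro rfl
  exact h

theorem sdiff_one_of_nil_notMem {K : Language β} (h : [] ∉ K) : K \ 1 = K := by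
  ext w
  rw [mem_sdiff_language, Language.mem_one]
  refine ⟨And.left, fun hw => ⟨hw, ?_⟩⟩
  rintro rfl
  exact h hw

theorem one_sdiff_mem (K : Language β) : 1 \ K = 0 ∨ 1 \ K = 1 := by
  by_cases h : [] ∈ K
  · left
    ext w
    rw [mem_sdiff_language, Language.mem_one]
    simp only [Language.notMem_zero, iff_false, not_and, not_not]
    rintro rfl
    exact h
  · right
    ext w
    rw [mem_sdiff_language, Language.mem_one, and_iff_left_iff_imp]
    rintro rfl
    exact h

/-- The bound for union and symmetric difference. -/
theorem κ_op_le {m n : ℕ} (hm : 4 ≤ m) (hn : 4 ≤ n)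
    (op : Language β → Language β → Language β)
    (hq : ∀ K L w, (op K L).leftQuotient w = op (K.leftQuotient w) (L.leftQuotient w))
    (h0 : ∀ K, op 0 K = K) (h10 : op 1 0 = 1) (h11 : op 1 1 = 0 ∨ op 1 1 = 1)
    {L' L : Language β} (h' : IsPrefixFreeOf m L') (h : IsPrefixFreeOf n L) :
    κ (op L' L) ≤ (m * n - 2 : ℕ) := by
  classical
  obtain ⟨P', hcard', -, -, hP'⟩ := h'.exists_finset hm
  obtain ⟨P, hcard, -, -, hP⟩ := h.exists_finset hn
  set Q := insert 0 (insert 1 P) with hQ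
  have hQcard : Q.card ≤ n := by
    rw [hQ]
    have h3 := Finset.card_insert_le 0 (insert 1 P)
    have h4 := Finset.card_insert_le 1 P
    omega
  -- For `K'` in `P'` there are `(m - 2) * n` pairs, for `K' = ∅` just the `n` quotients of `L`. For
  -- `K' = {ε}` only `K ∈ P` gives anything new, so the sum is `(m - 2) * n + n + (n - 2)`.
  have hle := κ_le_of_range_subset (L := op L' L)
    (((P' ×ˢ Q).image fun x => op x.1 x.2) ∪ (Q ∪ P.image (op 1))) fun w => by
      rw [hq]
      have hK' : L'.leftQuotient w ∈ Set.range L'.leftQuotient := ⟨w, rfl⟩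
      have hK : L.leftQuotient w ∈ Set.range L.leftQuotient := ⟨w, rfl⟩
      generalize L'.leftQuotient w = K' at *
      generalize L.leftQuotient w = K at *
      have hKQ : K ∈ Q := by
        rw [hP] at hK
        simpa [hQ] using hK
      rw [hP'] at hK'
      rw [hP] at hK
      rcases hK' with rfl | rfl | hK'
      · rw [h0]
        exact Finset.mem_union_right _ (Finset.mem_union_left _ hKQ)
      · refine Finset.mem_union_right _ ?_
        rcases hK with rfl | rfl | hK
        · rw [h10]
          exact Finset.mem_union_left _ (by simp [hQ])
        · exact Finset.mem_union_left _ (by rcases h11 with h | h <;> rw [h] <;> simp [hQ])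
        · exact Finset.mem_union_right _ (Finset.mem_image_of_mem _ hK)
      · exact Finset.mem_union_left _ (Finset.mem_image.2 ⟨(K', K), by
          simp only [Finset.mem_product]; exact ⟨hK', hKQ⟩, rfl⟩)
  refine hle.trans (Nat.cast_le.2 ?_)
  have h1 : ((P' ×ˢ Q).image fun x => op x.1 x.2).card ≤ _ := Finset.card_image_le
  have h2 : (P.image (op 1)).card ≤ _ := Finset.card_image_le
  have h3 := Finset.card_union_le ((P' ×ˢ Q).image fun x => op x.1 x.2) (Q ∪ P.image (op 1))
  have h4 := Finset.card_union_le Q (P.image (op 1))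
  rw [Finset.card_product, hcard'] at h1
  have h5 := Nat.mul_le_mul_left (m - 2) hQcard
  have h6 : (m - 2) * n + 2 * n = m * n := by rw [← add_mul]; congr 1; omega
  omega

theorem κ_sdiff_le {m n : ℕ} (hm : 4 ≤ m) (hn : 4 ≤ n)
    {L' L : Language β} (h' : IsPrefixFreeOf m L') (h : IsPrefixFreeOf n L) :
    κ (L' \ L) ≤ (m * n - (m + 2 * n - 4) : ℕ) := by
  classical
  obtain ⟨P', hcard', hnil', -, hP'⟩ := h'.exists_finset hm
  obtain ⟨P, hcard, -, -, hP⟩ := h.exists_finset hn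
  -- With `K'` equal to `∅` or `{ε}` the difference is `∅` or `{ε}`. For other `K'`, subtracting
  -- `{ε}` is the same as subtracting `∅`, so the count is `(m - 2) * (n - 1) + 2`.
  have hle := κ_le_of_range_subset (L := L' \ L)
    (((P' ×ˢ insert 0 P).image fun x => x.1 \ x.2) ∪ {0, 1}) fun w => by
      rw [leftQuotient_sdiff]
      have hK' : L'.leftQuotient w ∈ Set.range L'.leftQuotient := ⟨w, rfl⟩
      have hK : L.leftQuotient w ∈ Set.range L.leftQuotient := ⟨w, rfl⟩
      generalize L'.leftQuotient w = K' at *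
      generalize L.leftQuotient w = K at *
      rw [hP'] at hK'
      rw [hP] at hK
      rw [Finset.mem_union]
      rcases hK' with rfl | rfl | hK'
      · right
        rw [zero_eq_bot_language, bot_sdiff]
        simp
      · right
        rcases one_sdiff_mem K with h | h <;> rw [h] <;> simp
      · left
        rcases hK with rfl | rfl | hK
        · exact Finset.mem_image.2 ⟨(K', 0), by simpa using hK', rfl⟩
        · exact Finset.mem_image.2 ⟨(K', 0), by simpa using hK', by
            rw [sdiff_one_of_nil_notMem (hnil' _ hK')]; exact sdiff_bot⟩
        · exact Finset.mem_image.2 ⟨(K', K), by simpa using ⟨hK', Or.inr hK⟩, rfl⟩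
  refine hle.trans (Nat.cast_le.2 ?_)
  have h1 : ((P' ×ˢ insert 0 P).image fun x => x.1 \ x.2).card ≤ _ := Finset.card_image_le
  have h3 := Finset.card_union_le ((P' ×ˢ insert 0 P).image fun x => x.1 \ x.2) {0, 1}
  have h4 : ({0, 1} : Finset (Language β)).card ≤ 2 := Finset.card_le_two
  rw [Finset.card_product, hcard'] at h1
  have h5 := Nat.mul_le_mul_left (m - 2) ((Finset.card_insert_le 0 P).trans_eq (by rw [hcard]))
  have h6 : (m - 2) * (n - 2 + 1) + 2 = m * n - (m + 2 * n - 4) := by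
    obtain ⟨m, rfl⟩ := Nat.exists_eq_add_of_le hm
    obtain ⟨n, rfl⟩ := Nat.exists_eq_add_of_le hn
    rw [show 4 + m - 2 = m + 2 by omega, show 4 + n - 2 + 1 = n + 3 by omega,
      show 4 + m + 2 * (4 + n) - 4 = m + 2 * n + 8 by omega]
    refine Nat.eq_sub_of_add_eq ?_
    ring
  omega

theorem κ_inf_le {m n : ℕ} (hm : 4 ≤ m) (hn : 4 ≤ n)
    {L' L : Language β} (h' : IsPrefixFreeOf m L') (h : IsPrefixFreeOf n L) :
    κ (L' ⊓ L) ≤ (m * n - 2 * (m + n - 3) : ℕ) := by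
  classical
  obtain ⟨P', hcard', hnil', -, hP'⟩ := h'.exists_finset hm
  obtain ⟨P, hcard, hnil, -, hP⟩ := h.exists_finset hn
  -- A pair with `∅` or `{ε}` in it intersects in `∅` or `{ε}`, so the count is `(m - 2) * (n - 2) +
  -- 2`.
  have hle := κ_le_of_range_subset (L := L' ⊓ L)
    (((P' ×ˢ P).image fun x => x.1 ⊓ x.2) ∪ {0, 1}) fun w => by
      rw [leftQuotient_inf]
      have hK' : L'.leftQuotient w ∈ Set.range L'.leftQuotient := ⟨w, rfl⟩
      have hK : L.leftQuotient w ∈ Set.range L.leftQuotient := ⟨w, rfl⟩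
      generalize L'.leftQuotient w = K' at *
      generalize L.leftQuotient w = K at *
      rw [hP'] at hK'
      rw [hP] at hK
      rw [Finset.mem_union]
      rcases hK' with rfl | rfl | hK'
      · simp
      · right
        rcases hK with rfl | rfl | hK
        · simp
        · simp
        · simp [one_inf_of_nil_notMem (hnil K hK)]
      · rcases hK with rfl | rfl | hK
        · simp
        · simp [inf_comm _ (1 : Language β), one_inf_of_nil_notMem (hnil' K' hK')]
        · exact Or.inl (Finset.mem_image.2 ⟨(K', K), by simpa using ⟨hK', hK⟩, rfl⟩)
  refine hle.trans (Nat.cast_le.2 ?_)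
  have h1 : ((P' ×ˢ P).image fun x => x.1 ⊓ x.2).card ≤ _ := Finset.card_image_le
  have h3 := Finset.card_union_le ((P' ×ˢ P).image fun x => x.1 ⊓ x.2) {0, 1}
  have h4 : ({0, 1} : Finset (Language β)).card ≤ 2 := Finset.card_le_two
  rw [Finset.card_product, hcard', hcard] at h1
  have h6 : (m - 2) * (n - 2) + 2 = m * n - 2 * (m + n - 3) := by
    obtain ⟨m, rfl⟩ := Nat.exists_eq_add_of_le hm
    obtain ⟨n, rfl⟩ := Nat.exists_eq_add_of_le hn
    rw [show 4 + m - 2 = m + 2 by omega, show 4 + n - 2 = n + 2 by omega,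
      show 2 * (4 + m + (4 + n) - 3) = 2 * m + 2 * n + 10 by omega]
    refine Nat.eq_sub_of_add_eq ?_
    ring
  omega

end Boolean

/-- Each letter advances one component and leaves the other in place, unless that one is final, in
which case it dies. Hence a component that is to end in its final state must be moved last. -/
theorem union_witness_reach {β : Type} {m n : ℕ} (hm : 4 ≤ m) (hn : 4 ≤ n) {σ τ : β → Letter}
    {b c : β} (hσb : σ b = .f) (hσc : σ c = .g) (hτb : τ b = .g) (hτc : τ c = .f) {p q : ℕ}
    (hp : p < m) (hq : q < n) (hpq : p = m - 2 → q < n - 2) :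
    ∃ w : List β, run m (w.map σ) 0 = p ∧ run n (w.map τ) 0 = q := by
  by_cases h : p = m - 2
  · refine ⟨List.replicate q c ++ List.replicate p b, ?_, ?_⟩
    · rw [List.map_append, run_append, List.map_replicate, List.map_replicate, hσb, hσc,
        run_replicate_fixed _ (act_g (by omega)), run_replicate_f hm _ (by omega)]
      omega
    · rw [List.map_append, run_append, List.map_replicate, List.map_replicate, hτb, hτc,
        run_replicate_f hn _ (by omega), run_replicate_fixed _ (act_g (by omega))]
      omega
  · refine ⟨List.replicate p b ++ List.replicate q c, ?_, ?_⟩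
    · rw [List.map_append, run_append, List.map_replicate, List.map_replicate, hσb, hσc,
        run_replicate_f hm _ (by omega), run_replicate_fixed _ (act_g (by omega))]
      omega
    · rw [List.map_append, run_append, List.map_replicate, List.map_replicate, hτb, hτc,
        run_replicate_fixed _ (act_g (by omega)), run_replicate_f hn _ (by omega)]
      omega

/-- The block `c ^ n` drives every state of the second component to the dead state, while it fixes
the states below `m - 2` of the first. The following block of `b` then counts the distance from `p`
to the final state. -/
theorem exists_mem_iff_of_f_of_g {β : Type} {m n : ℕ} (hm : 4 ≤ m) (hn : 4 ≤ n)
    {σ τ : β → Letter} {b c : β} (hσb : σ b = .f) (hσc : σ c = .g) (hτc : τ c = .f) {p : ℕ}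
    (hp : p < m - 2) : ∃ w : List β, (∀ x < m, w ∈ stateLang m σ x ↔ x = p) ∧
      ∀ y < n, w ∉ stateLang n τ y := by
  refine ⟨List.replicate n c ++ List.replicate (m - 2 - p) b, fun x hx => ?_, fun y hy => ?_⟩
  · rw [mem_stateLang]
    by_cases hx2 : x < m - 2
    · rw [List.map_append, run_append, List.map_replicate, List.map_replicate, hσb, hσc,
        run_replicate_fixed _ (act_g (by omega)), run_replicate_f hm _ (by omega)]
      omega
    · rw [run_ge hm (by simp; omega) (by omega) hx]
      omega
  · rw [mem_stateLang, List.map_append, run_append, List.map_replicate, List.map_replicate, hτc,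
      run_replicate_f hn _ hy, show min (y + n) (n - 1) = n - 1 by omega, run_dead hn]
    omega

/-- The witnesses for union and symmetric difference. -/
theorem le_κ_op_stateLang {β : Type} {m n : ℕ} (hm : 4 ≤ m) (hn : 4 ≤ n) {σ τ : β → Letter}
    {b c : β} (hσb : σ b = .f) (hσc : σ c = .g) (hτb : τ b = .g) (hτc : τ c = .f)
    (op : Language β → Language β → Language β)
    (hq : ∀ K L w, (op K L).leftQuotient w = op (K.leftQuotient w) (L.leftQuotient w))
    (hl : ∀ K L w, w ∉ L → (w ∈ op K L ↔ w ∈ K)) (hr : ∀ K L w, w ∉ K → (w ∈ op K L ↔ w ∈ L)) :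
    (m * n - 2 : ℕ) ≤ κ (op (stateLang m σ 0) (stateLang n τ 0)) := by
  have hcard : ((Finset.range m ×ˢ Finset.range n) \ {(m - 2, n - 2), (m - 2, n - 1)}).card =
      m * n - 2 := by
    rw [Finset.card_sdiff_of_subset, Finset.card_product, Finset.card_range, Finset.card_range,
      Finset.card_pair]
    · simp
      omega
    · intro x
      simp only [Finset.mem_insert, Finset.mem_singleton, Finset.mem_product, Finset.mem_range]
      rintro (rfl | rfl) <;> simp <;> omega
  rw [← hcard]
  refine le_κ_of_injOn _ (fun x : ℕ × ℕ => op (stateLang m σ x.1) (stateLang n τ x.2)) ?_ ?_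
  · rintro ⟨p, q⟩ hx ⟨p', q'⟩ hx' heq
    simp only [Finset.coe_sdiff, Set.mem_sdiff, Finset.mem_coe, Finset.mem_product, Finset.mem_range,
      Finset.mem_insert, Finset.mem_singleton, Prod.mk.injEq] at hx hx' heq
    -- Words rejected from every state of one component read off the other. This determines each
    -- coordinate up to confusing its final with its dead state.
    have hp : ∀ x < m - 2, p = x ↔ p' = x := by
      intro x hx2
      obtain ⟨w, hw, hw'⟩ := exists_mem_iff_of_f_of_g hm hn hσb hσc hτc hx2
      rw [← hw p hx.1.1, ← hw p' hx'.1.1, ← hl _ _ w (hw' q hx.1.2), heq, hl _ _ w (hw' q' hx'.1.2)]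
    have hq' : ∀ y < n - 2, q = y ↔ q' = y := by
      intro y hy2
      obtain ⟨w, hw, hw'⟩ := exists_mem_iff_of_f_of_g hn hm hτc hτb hσb hy2
      rw [← hw q hx.1.2, ← hw q' hx'.1.2, ← hr _ _ w (hw' p hx.1.1), heq, hr _ _ w (hw' p' hx'.1.1)]
    have hpp := hp p
    have hpp' := hp p'
    have hqq := hq' q
    have hqq' := hq' q'
    -- The empty word now tells final from dead. It is decisive because the two pairs left out of
    -- the count are those with first coordinate final and second coordinate at least `n - 2`.
    have hnl : q < n - 2 → (p = m - 2 ↔ p' = m - 2) := fun hlt => by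
      have h1 := hl (stateLang m σ p) (stateLang n τ q) [] (by rw [nil_mem_stateLang]; omega)
      have h2 := hl (stateLang m σ p') (stateLang n τ q') [] (by rw [nil_mem_stateLang]; omega)
      rw [nil_mem_stateLang] at h1 h2
      rw [← h1, heq, h2]
    have hnr : p ≠ m - 2 → p' ≠ m - 2 → (q = n - 2 ↔ q' = n - 2) := fun hne hne' => by
      have h1 := hr (stateLang m σ p) (stateLang n τ q) [] (by rwa [nil_mem_stateLang])
      have h2 := hr (stateLang m σ p') (stateLang n τ q') [] (by rwa [nil_mem_stateLang])
      rw [nil_mem_stateLang] at h1 h2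
      rw [← h1, heq, h2]
    rw [Prod.mk.injEq]
    omega
  · rintro ⟨p, q⟩ hx
    simp only [Finset.mem_sdiff, Finset.mem_product, Finset.mem_range,
      Finset.mem_insert, Finset.mem_singleton, Prod.mk.injEq] at hx
    obtain ⟨w, hw, hw'⟩ := union_witness_reach hm hn hσb hσc hτb hτc hx.1.1 hx.1.2 (by omega)
    exact ⟨w, by rw [hq, leftQuotient_stateLang, leftQuotient_stateLang, hw, hw']⟩

/-- Serves difference and intersection: beyond the family indexed by `s`, the quotients `{ε}` and
`∅` contribute the two extra ones, and `∅` follows `{ε}` by any letter. -/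
theorem card_add_two_le_κ {β ι : Type} {L : Language β} (b : β) (s : Finset ι) (f : ι → Language β)
    (hf : Set.InjOn f s) (h : ∀ i ∈ s, ∃ w, L.leftQuotient w = f i) (hnil : ∀ i ∈ s, [] ∉ f i)
    (h0 : ∀ i ∈ s, f i ≠ 0) (h1 : ∃ w, L.leftQuotient w = 1) : (s.card + 2 : ℕ) ≤ κ L := by
  classical
  have hcard : (insert 0 (insert 1 (s.image f))).card = s.card + 2 := by
    rw [Finset.card_insert_of_notMem, Finset.card_insert_of_notMem, Finset.card_image_of_injOn hf]
    · intro hmem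
      obtain ⟨i, hi, hi1⟩ := Finset.mem_image.1 hmem
      exact hnil i hi (hi1 ▸ Language.nil_mem_one)
    · intro hmem
      rcases Finset.mem_insert.1 hmem with hmem | hmem
      · exact zero_ne_one_language hmem
      · obtain ⟨i, hi, hi1⟩ := Finset.mem_image.1 hmem
        exact h0 i hi hi1
  rw [← hcard]
  refine le_κ_of_injOn _ id Function.injective_id.injOn fun K hK => ?_
  rcases Finset.mem_insert.1 hK with rfl | hK
  · obtain ⟨w, hw⟩ := h1
    exact ⟨w ++ [b], by rw [Language.leftQuotient_append, hw, leftQuotient_one_cons]; rfl⟩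
  · rcases Finset.mem_insert.1 hK with rfl | hK
    · exact h1
    · obtain ⟨i, hi, rfl⟩ := Finset.mem_image.1 hK
      exact h i hi

section SdiffInf

variable {β : Type} {m n : ℕ} {σ τ : β → Letter} {b c : β}

/-- The second component moves first, while `e` fixes the state `0` of the first; then the first
rotates while `g` fixes `q`, which is not final. -/
theorem inf_witness_reach (hm : 4 ≤ m) (hn : 4 ≤ n) (hσb : σ b = .a) (hσc : σ c = .e)
    (hτb : τ b = .g) (hτc : τ c = .f) {p q : ℕ} (hp : p < m - 2) (hq : q < n) (hq2 : q ≠ n - 2) :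
    ∃ w : List β, run m (w.map σ) 0 = p ∧ run n (w.map τ) 0 = q := by
  refine ⟨List.replicate q c ++ List.replicate p b, ?_, ?_⟩
  · rw [List.map_append, run_append, List.map_replicate, List.map_replicate, hσb, hσc,
      run_replicate_fixed _ (act_e (by omega)), run_replicate_a _ (by omega), zero_add,
      Nat.mod_eq_of_lt hp]
  · rw [List.map_append, run_append, List.map_replicate, List.map_replicate, hτb, hτc,
      run_replicate_f hn _ (by omega), run_replicate_fixed _ (act_g (by omega))]
    omega

/-- The word `a ^ (m - 3) e` is accepted from `0` alone among the states below `m - 2`. The prefix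
`e ^ k` can only kill `m - 3`, which is different from `0`, so it changes nothing. -/
theorem run_e_a_e_eq_final_iff (hm : 4 ≤ m) (k : ℕ) {r : ℕ} (hr : r < m - 2) :
    run m (List.replicate k .e ++ (List.replicate (m - 3) .a ++ [.e])) r = m - 2 ↔ r = 0 := by
  have key : ∀ r < m - 2, run m (List.replicate (m - 3) .a ++ [.e]) r = m - 2 ↔ r = 0 := by
    intro r hr
    rw [run_append, run_replicate_a _ hr, run_cons, run_nil,
      act_e_eq_final_iff hm _ (Nat.mod_lt _ (by omega)), show m - 3 = m - 2 + (m - 3) - (m - 2) by omega]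
    rcases Nat.eq_zero_or_pos r with rfl | hpos
    · simp
      rw [Nat.mod_eq_of_lt (by omega)]
    · rw [show r + (m - 2 + (m - 3) - (m - 2)) = r - 1 + (m - 2) by omega, Nat.add_mod_right,
        Nat.mod_eq_of_lt (by omega)]
      omega
  by_cases hr3 : r < m - 3
  · rw [run_append, run_replicate_fixed _ (act_e hr3), key r hr]
  · obtain rfl : r = m - 3 := by omega
    cases k with
    | zero => exact key _ hr
    | succ k =>
      rw [List.replicate_succ, List.cons_append, run_cons, act_e_eq, run_final hm (by simp)]
      omega

/-- This is how the word of `run_e_a_e_eq_final_iff` acts on the second component. The block of `g`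
fixes the non-final states, and a state that gets to `n - 2` too early is dead after the remaining
letters. -/
theorem run_f_g_f_eq_final_iff (hn : 4 ≤ n) (k l : ℕ) {y : ℕ} (hy : y < n) :
    run n (List.replicate k .f ++ (List.replicate l .g ++ [.f])) y = n - 2 ↔ y + k = n - 3 := by
  rw [run_append, run_replicate_f hn _ hy]
  by_cases h : n - 2 ≤ min (y + k) (n - 1)
  · rw [run_ge hn (by simp) h (by omega)]
    omega
  · rw [run_append, run_replicate_fixed _ (act_g (by omega)), run_cons, run_nil]
    simp only [act]
    split_ifs <;> omega

/-- The first block turns `p` to `0`. The second lifts `q` to `n - 3` without affecting `0` in the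
first component. The rest accepts from `0` in the first component and from `n - 3` in the second. -/
theorem exists_mem_iff_of_a_of_e (hm : 4 ≤ m) (hn : 4 ≤ n) (hσb : σ b = .a) (hσc : σ c = .e)
    (hτb : τ b = .g) (hτc : τ c = .f) {p q : ℕ} (hp : p < m - 2) (hq : q < n - 2) :
    ∃ w : List β, (∀ x < m - 2, w ∈ stateLang m σ x ↔ x = p) ∧
      ∀ y < n, w ∈ stateLang n τ y ↔ y = q := by
  refine ⟨List.replicate (m - 2 - p) b ++ (List.replicate (n - 3 - q) c ++
    (List.replicate (m - 3) b ++ [c])), fun x hx => ?_, fun y hy => ?_⟩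
  · rw [mem_stateLang]
    simp only [List.map_append, List.map_replicate, List.map_cons, List.map_nil, hσb, hσc]
    rw [run_append, run_replicate_a _ hx, run_e_a_e_eq_final_iff hm _ (Nat.mod_lt _ (by omega)),
      show m - 2 - p = m - 2 + 0 - p by omega, add_mod_eq_iff hx hp (by omega)]
  · rw [mem_stateLang]
    simp only [List.map_append, List.map_replicate, List.map_cons, List.map_nil, hτb, hτc]
    by_cases hy2 : n - 2 ≤ y
    · rw [run_ge hn (by simp) hy2 hy]
      omega
    · rw [run_append, run_replicate_fixed _ (act_g (by omega)),
        run_f_g_f_eq_final_iff hn _ _ hy]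
      omega

theorem le_κ_sdiff_stateLang (hm : 4 ≤ m) (hn : 4 ≤ n) (hσb : σ b = .a) (hσc : σ c = .e)
    (hτb : τ b = .g) (hτc : τ c = .f) :
    (m * n - (m + 2 * n - 4) : ℕ) ≤ κ (stateLang m σ 0 \ stateLang n τ 0) := by
  have hcard : (Finset.range (m - 2) ×ˢ (Finset.range n).erase (n - 2)).card + 2 =
      m * n - (m + 2 * n - 4) := by
    rw [Finset.card_product, Finset.card_erase_of_mem (Finset.mem_range.2 (by omega)),
      Finset.card_range, Finset.card_range]
    obtain ⟨m, rfl⟩ := Nat.exists_eq_add_of_le hm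
    obtain ⟨n, rfl⟩ := Nat.exists_eq_add_of_le hn
    rw [show 4 + m - 2 = m + 2 by omega, show 4 + n - 1 = n + 3 by omega,
      show 4 + m + 2 * (4 + n) - 4 = m + 2 * n + 8 by omega]
    refine Nat.eq_sub_of_add_eq ?_
    ring
  rw [← hcard]
  have hw := fun p hp q hq => exists_mem_iff_of_a_of_e (p := p) (q := q) hm hn hσb hσc hτb hτc hp hq
  -- A word accepted from `p` in the first component and from `j ≠ q` alone in the second survives
  -- the subtraction of the language of `q`; such a word identifies `p` and shows that the
  -- difference is nonempty.
  have hother : ∀ y, ∃ j < n - 2, j ≠ y := fun y => by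
    by_cases h : y = 0
    · exact ⟨1, by omega, by omega⟩
    · exact ⟨0, by omega, by omega⟩
  refine card_add_two_le_κ b _ (fun x : ℕ × ℕ => stateLang m σ x.1 \ stateLang n τ x.2) ?_ ?_ ?_ ?_ ?_
  · rintro ⟨p, q⟩ hx ⟨p', q'⟩ hx' heq
    simp only [Finset.coe_product, Set.mem_prod, Finset.mem_coe, Finset.mem_range,
      Finset.mem_erase] at hx hx' heq
    obtain rfl : p' = p := by
      obtain ⟨j, hj, hjq⟩ := hother q
      obtain ⟨w, h1, h2⟩ := hw p hx.1 j hj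
      have : w ∈ stateLang m σ p \ stateLang n τ q :=
        ⟨(h1 p hx.1).2 rfl, fun h => hjq ((h2 q hx.2.2).1 h).symm⟩
      rw [heq] at this
      exact (h1 p' hx'.1).1 this.1
    -- Once the first coordinates agree, a word accepted from that state and from `j` alone in the
    -- second component is subtracted exactly when the second coordinate is `j`. The only other
    -- possible value is the dead state.
    have key : ∀ j < n - 2, q = j ↔ q' = j := by
      intro j hj
      obtain ⟨w, h1, h2⟩ := hw p' hx.1 j hj
      have hmem := (h1 p' hx.1).2 rfl
      have h3 := congrArg (fun K : Language β => w ∈ K) heq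
      simp only [mem_sdiff_language, hmem, true_and, eq_iff_iff] at h3
      rw [← h2 q hx.2.2, ← h2 q' hx'.2.2]
      exact not_iff_not.1 h3
    have := key q
    have := key q'
    rw [Prod.mk.injEq]
    omega
  · rintro ⟨p, q⟩ hx
    simp only [Finset.mem_product, Finset.mem_range, Finset.mem_erase] at hx
    obtain ⟨w, h1, h2⟩ := inf_witness_reach hm hn hσb hσc hτb hτc hx.1 hx.2.2 hx.2.1
    exact ⟨w, by rw [leftQuotient_sdiff, leftQuotient_stateLang, leftQuotient_stateLang, h1, h2]⟩
  · rintro ⟨p, q⟩ hx hnil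
    simp only [Finset.mem_product, Finset.mem_range] at hx
    exact hx.1.ne (nil_mem_stateLang.1 hnil.1)
  · rintro ⟨p, q⟩ hx h0
    simp only [Finset.mem_product, Finset.mem_range, Finset.mem_erase] at hx h0
    obtain ⟨j, hj, hjq⟩ := hother q
    obtain ⟨w, h1, h2⟩ := hw p hx.1 j hj
    have : w ∈ stateLang m σ p \ stateLang n τ q :=
      ⟨(h1 p hx.1).2 rfl, fun h => hjq ((h2 q hx.2.2).1 h).symm⟩
    rw [h0] at this
    exact Language.notMem_zero _ this
  · obtain ⟨w, h1, h2⟩ := inf_witness_reach (p := m - 3) (q := 0) hm hn hσb hσc hτb hτc (by omega)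
      (by omega) (by omega)
    -- The letter `c` takes `(m - 3, 0)` to `(m - 2, 1)`, and `1` is not final, so that `{ε}` is
    -- left by the subtraction.
    refine ⟨w ++ [c], (one_sdiff_mem (stateLang n τ 1)).resolve_left ?_ |>.symm ▸ ?_⟩
    · intro h
      have : [] ∈ (1 : Language β) \ stateLang n τ 1 :=
        mem_sdiff_language.2 ⟨Language.nil_mem_one, by rw [nil_mem_stateLang]; omega⟩
      rw [h] at this
      exact Language.notMem_zero _ this
    · rw [leftQuotient_sdiff, leftQuotient_stateLang, leftQuotient_stateLang, List.map_append,
        List.map_append, run_append, run_append, h1, h2, ← stateLang_eq_one hm σ]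
      simp [hσc, hτc, act]

theorem le_κ_inf_stateLang (hm : 4 ≤ m) (hn : 4 ≤ n) (hσb : σ b = .a) (hσc : σ c = .e)
    (hτb : τ b = .g) (hτc : τ c = .f) :
    (m * n - 2 * (m + n - 3) : ℕ) ≤ κ (stateLang m σ 0 ⊓ stateLang n τ 0) := by
  have hcard : (Finset.range (m - 2) ×ˢ Finset.range (n - 2)).card + 2 =
      m * n - 2 * (m + n - 3) := by
    rw [Finset.card_product, Finset.card_range, Finset.card_range]
    obtain ⟨m, rfl⟩ := Nat.exists_eq_add_of_le hm
    obtain ⟨n, rfl⟩ := Nat.exists_eq_add_of_le hn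
    rw [show 4 + m - 2 = m + 2 by omega, show 4 + n - 2 = n + 2 by omega,
      show 2 * (4 + m + (4 + n) - 3) = 2 * m + 2 * n + 10 by omega]
    refine Nat.eq_sub_of_add_eq ?_
    ring
  rw [← hcard]
  have hw : ∀ p < m - 2, ∀ q < n - 2, ∃ w : List β, ∀ x < m - 2, ∀ y < n - 2,
      w ∈ stateLang m σ x ⊓ stateLang n τ y ↔ x = p ∧ y = q := fun p hp q hq => by
    obtain ⟨w, h1, h2⟩ := exists_mem_iff_of_a_of_e hm hn hσb hσc hτb hτc hp hq
    exact ⟨w, fun x hx y hy => by rw [Language.mem_inf, h1 x hx, h2 y (by omega)]⟩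
  refine card_add_two_le_κ b _ (fun x : ℕ × ℕ => stateLang m σ x.1 ⊓ stateLang n τ x.2) ?_ ?_ ?_ ?_ ?_
  · rintro ⟨p, q⟩ hx ⟨p', q'⟩ hx' heq
    simp only [Finset.coe_product, Set.mem_prod, Finset.mem_coe, Finset.mem_range] at hx hx' heq
    obtain ⟨w, h⟩ := hw p hx.1 q hx.2
    have := (h p hx.1 q hx.2).2 ⟨rfl, rfl⟩
    rw [heq, h p' hx'.1 q' hx'.2] at this
    rw [this.1, this.2]
  · rintro ⟨p, q⟩ hx
    simp only [Finset.mem_product, Finset.mem_range] at hx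
    obtain ⟨w, h1, h2⟩ := inf_witness_reach (q := q) hm hn hσb hσc hτb hτc hx.1 (by omega) (by omega)
    exact ⟨w, by rw [leftQuotient_inf, leftQuotient_stateLang, leftQuotient_stateLang, h1, h2]⟩
  · rintro ⟨p, q⟩ hx hnil
    simp only [Finset.mem_product, Finset.mem_range] at hx
    exact hx.1.ne (nil_mem_stateLang.1 hnil.1)
  · rintro ⟨p, q⟩ hx h0
    simp only [Finset.mem_product, Finset.mem_range] at hx h0
    obtain ⟨w, h⟩ := hw p hx.1 q hx.2
    have := (h p hx.1 q hx.2).2 ⟨rfl, rfl⟩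
    rw [h0] at this
    exact Language.notMem_zero _ this
  · obtain ⟨w, h1, h2⟩ := inf_witness_reach (p := m - 3) (q := n - 3) hm hn hσb hσc hτb hτc
      (by omega) (by omega) (by omega)
    -- Both components become final at once: `e` takes `m - 3` to `m - 2`, and `f` takes `n - 3` to
    -- `n - 2`.
    refine ⟨w ++ [c], ?_⟩
    rw [leftQuotient_inf, leftQuotient_stateLang, leftQuotient_stateLang, List.map_append,
      List.map_append, run_append, run_append, h1, h2]
    have hf : act n .f (n - 3) = n - 2 := by
      simp only [act]
      split_ifs <;> omega
    simp only [List.map_cons, List.map_nil, run_cons, run_nil, hσc, hτc, act_e_eq, hf,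
      stateLang_eq_one hm, stateLang_eq_one hn]
    exact inf_idem _

end SdiffInf

/-! ### Reversal and atoms -/

theorem encard_range_le_of_factors {ι γ δ : Type} {f : ι → γ} {g : ι → δ}
    (h : ∀ x y, f x = f y → g x = g y) : (Set.range g).encard ≤ (Set.range f).encard := by
  rcases isEmpty_or_nonempty ι with hι | ⟨⟨i⟩⟩
  · simp only [Set.range_eq_empty, Set.encard_empty, le_refl]
  have : Set.range g = Function.extend f g (fun _ => g i) '' Set.range f := by
    rw [← Set.range_comp]
    congr 1
    funext x
    exact (Function.FactorsThrough.extend_apply (fun x y hxy => h x y hxy) _ x).symm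
  rw [this]
  exact Set.encard_image_le _ _

/-- The words that complete `x` to a word of `L` on the left. -/
def leftContexts {β : Type} (L : Language β) (x : List β) : Set (List β) :=
  {u | u ++ x ∈ L}

theorem mem_leftContexts {β : Type} {L : Language β} {x u : List β} :
    u ∈ leftContexts L x ↔ u ++ x ∈ L := Iff.rfl

/-- The quotient of the reverse by `x.reverse` consists of the reversals of the left contexts of
`x`, so both determine each other. -/
theorem κ_reverse_eq {β : Type} (L : Language β) :
    κ L.reverse = (Set.range (leftContexts L)).encard := by
  have hiff : ∀ x y : List β, L.reverse.leftQuotient x.reverse = L.reverse.leftQuotient y.reverse ↔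
      leftContexts L x = leftContexts L y := by
    intro x y
    constructor
    · intro h
      ext u
      have : u.reverse ∈ L.reverse.leftQuotient x.reverse ↔
        u.reverse ∈ L.reverse.leftQuotient y.reverse := by rw [h]
      rw [mem_leftContexts, mem_leftContexts]
      simpa [Language.mem_reverse] using this
    · intro h
      ext u
      have : u.reverse ∈ leftContexts L x ↔ u.reverse ∈ leftContexts L y := by rw [h]
      simpa [Language.mem_reverse, mem_leftContexts] using this
  have hκ : κ L.reverse =
      (Set.range fun x : List β => L.reverse.leftQuotient x.reverse).encard := by
    rw [κ]
    congr 1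
    exact (List.reverse_surjective.range_comp _).symm
  rw [hκ]
  exact le_antisymm (encard_range_le_of_factors fun x y h => (hiff x y).2 h)
    (encard_range_le_of_factors fun x y h => (hiff x y).1 h)

/-- The atom of `x` is the fibre of `leftContexts L` through `x`, so atoms correspond to distinct
left contexts. -/
theorem encard_atoms {β : Type} (L : Language β) : (atoms L).encard = κ L.reverse := by
  rw [κ_reverse_eq]
  refine le_antisymm (encard_range_le_of_factors fun x y h => ?_)
    (encard_range_le_of_factors fun x y h => ?_)
  · ext z
    have hu : ∀ u, u ++ x ∈ L ↔ u ++ y ∈ L := fun u => by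
      rw [← mem_leftContexts, h, mem_leftContexts]
    simp [hu]
  · have hy : y ∈ {z | ∀ u : List β, u ++ y ∈ L ↔ u ++ z ∈ L} := fun u => Iff.rfl
    rw [← h] at hy
    ext u
    exact hy u

section Signature

open Classical in
/-- The states of `P` from which the nonempty word `x` is accepted; `none` for the empty word. -/
noncomputable def signature {β ι : Type} (P : Finset ι) (f : ι → Language β) (x : List β) :
    Option (Finset ι) :=
  if x = [] then none else some (P.filter fun i => x ∈ f i)

theorem signature_mem {β ι : Type} (P : Finset ι) (f : ι → Language β) (x : List β) :
    signature P f x ∈ P.powerset.insertNone := by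
  classical
  rw [signature]
  split_ifs with h
  · exact Finset.none_mem_insertNone
  · exact Finset.some_mem_insertNone.2 (Finset.mem_powerset.2 (Finset.filter_subset _ _))

theorem card_signatures {ι : Type} (P : Finset ι) :
    P.powerset.insertNone.card = 2 ^ P.card + 1 := by
  rw [Finset.card_insertNone, Finset.card_powerset]

theorem encard_range_signature_le {β ι : Type} (P : Finset ι) (f : ι → Language β) :
    (Set.range (signature P f)).encard ≤ (2 ^ P.card + 1 : ℕ) := by
  rw [← card_signatures, ← Set.encard_coe_eq_coe_finsetCard]
  exact Set.encard_le_encard (Set.range_subset_iff.2 (signature_mem P f))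

theorem mem_iff_of_signature_eq {β ι : Type} {P : Finset ι} {f : ι → Language β} {x y : List β}
    (h : signature P f x = signature P f y) : (x = [] ↔ y = []) ∧ ∀ i ∈ P, x ∈ f i ↔ y ∈ f i := by
  classical
  simp only [signature] at h
  split_ifs at h with h1 h2 h2
  · simp [h1, h2]
  · refine ⟨by simp [h1, h2], fun i hi => ?_⟩
    have := congrArg (i ∈ ·) (Option.some_injective _ h)
    simpa [hi] using this

/-- A word `u` is a left context of `x` iff `x` lies in the quotient by `u`. The quotient `∅`
contains nothing and `{ε}` only tests whether `x` is empty, so the signature carries all the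
information. -/
theorem κ_reverse_le_signature {β : Type} {L : Language β}
    {P : Finset (Language β)}
    (hP : Set.range L.leftQuotient = insert 0 (insert 1 (P : Set (Language β)))) :
    κ L.reverse ≤ (Set.range (signature P id)).encard := by
  rw [κ_reverse_eq]
  refine encard_range_le_of_factors fun x y hxy => ?_
  obtain ⟨hnil, hmem⟩ := mem_iff_of_signature_eq hxy
  ext u
  rw [mem_leftContexts, mem_leftContexts, ← Language.mem_leftQuotient, ← Language.mem_leftQuotient]
  have hu : L.leftQuotient u ∈ Set.range L.leftQuotient := ⟨u, rfl⟩
  generalize L.leftQuotient u = K at hu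
  rw [hP] at hu
  rcases hu with rfl | rfl | hu
  · simp
  · rw [Language.mem_one, Language.mem_one, hnil]
  · exact hmem K hu

theorem κ_reverse_le {β : Type} {n : ℕ} (hn : 4 ≤ n) {L : Language β} (h : IsPrefixFreeOf n L) :
    κ L.reverse ≤ (2 ^ (n - 2) + 1 : ℕ) := by
  obtain ⟨P, hcard, -, -, hP⟩ := h.exists_finset hn
  rw [← hcard]
  exact (κ_reverse_le_signature hP).trans (encard_range_signature_le P id)

/-- When the bound is attained, the signature map fills its finite codomain, so every subset of `P`
is the signature of a nonempty word. -/
theorem exists_forall_mem_iff_of_κ_reverse_eq {β : Type} {n : ℕ} {L : Language β}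
    {P : Finset (Language β)} (hcard : P.card = n - 2)
    (hP : Set.range L.leftQuotient = insert 0 (insert 1 (P : Set (Language β))))
    (hκ : κ L.reverse = (2 ^ (n - 2) + 1 : ℕ)) (S : Set (Language β)) :
    ∃ x : List β, x ≠ [] ∧ ∀ K ∈ P, x ∈ K ↔ K ∈ S := by
  classical
  have heq : Set.range (signature P id) = P.powerset.insertNone := by
    refine (Finset.finite_toSet _).eq_of_subset_of_encard_le'
      (Set.range_subset_iff.2 (signature_mem P id)) ?_
    rw [Set.encard_coe_eq_coe_finsetCard, card_signatures, hcard, ← hκ]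
    exact κ_reverse_le_signature hP
  obtain ⟨x, hx⟩ : some (P.filter (· ∈ S)) ∈ Set.range (signature P id) := by
    rw [heq]
    exact Finset.mem_coe.2 (Finset.some_mem_insertNone.2
      (Finset.mem_powerset.2 (Finset.filter_subset _ _)))
  rw [signature] at hx
  split_ifs at hx with h1
  refine ⟨x, h1, fun K hK => ?_⟩
  have := congrArg (K ∈ ·) (Option.some_injective _ hx)
  simpa [hK] using this

end Signature

/-! #### Two letters do not suffice -/

/-- Two partial transformations of a set with at least three elements, each of which may send some of
the remaining elements to a final state, do not yield all subsets as sets of states accepting a nonempty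
word. -/
theorem not_forall_exists_accepting_eq {β ι : Type} [Finite ι] [Nonempty ι]
    (hι : ∀ i j : ι, ∃ l, l ≠ i ∧ l ≠ j) (hβ : ∀ z : β, ∃ z', ∀ b, b = z ∨ b = z')
    (X : List β → Set ι) (T : β → ι → Option ι) (F : β → Set ι) (hX₁ : ∀ b, X [b] = F b)
    (hX : ∀ b w, w ≠ [] → ∀ i, i ∈ X (b :: w) ↔ ∃ j, T b i = some j ∧ j ∈ X w)
    (hF : ∀ b, ∀ i ∈ F b, T b i = none) : ¬ ∀ S : Set ι, ∃ w, w ≠ [] ∧ X w = S := by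
  intro hall
  obtain ⟨o⟩ := ‹Nonempty ι›
  -- By the first letter of a word that realizes it, every subset is some `F b` or a preimage under
  -- some `T b`. The full set is examined first.
  have hinv : ∀ S : Set ι, ∃ b, S = F b ∨ ∃ S' : Set ι, ∀ i, i ∈ S ↔ ∃ j, T b i = some j ∧ j ∈ S' := by
    intro S
    obtain ⟨w, hw, rfl⟩ := hall S
    cases w with
    | nil => exact absurd rfl hw
    | cons b w =>
      refine ⟨b, ?_⟩
      by_cases hw' : w = []
      · subst hw'
        exact Or.inl (hX₁ b)
      · exact Or.inr ⟨X w, hX b w hw'⟩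
  by_cases hfull : ∃ z, F z = Set.univ
  · obtain ⟨z, hz⟩ := hfull
    obtain ⟨z', hzz'⟩ := hβ z
    have hTz : ∀ i, T z i = none := fun i => hF z i (hz ▸ Set.mem_univ i)
    by_cases hd : ∃ d, T z' d = none
    · obtain ⟨d, hd⟩ := hd
      -- No preimage under `T z` or `T z'` contains `d`, so `F z'` is the only proper subset that
      -- can contain it; but `{d}` and `{d, l}` are two.
      have key : ∀ S : Set ι, d ∈ S → S ≠ Set.univ → S = F z' := by
        intro S hdS hne
        obtain ⟨b, h | ⟨S', hS'⟩⟩ := hinv S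
        · rcases hzz' b with rfl | rfl
          · exact absurd (h.trans hz) hne
          · exact h
        · obtain ⟨j, hj, -⟩ := (hS' d).1 hdS
          rcases hzz' b with rfl | rfl
          · simp [hTz] at hj
          · simp [hd] at hj
      obtain ⟨l, hl, -⟩ := hι d d
      obtain ⟨k, hkd, hkl⟩ := hι d l
      have h1 := key {d} rfl fun h => hl (by
        have : l ∈ ({d} : Set ι) := h ▸ Set.mem_univ l
        exact this)
      have h2 := key {d, l} (by simp) fun h => by
        have : k ∈ ({d, l} : Set ι) := h ▸ Set.mem_univ k
        simp [hkd, hkl] at this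
      have : l ∈ ({d} : Set ι) := by
        rw [h1, ← h2]
        simp
      exact hl this
    -- If `T z'` is total, then `F z'` is empty and only the full and the empty set arise, so no
    -- singleton does.
    · have htriv : ∀ w : List β, w ≠ [] → X w = Set.univ ∨ X w = ∅ := by
        intro w
        induction w with
        | nil => exact fun h => absurd rfl h
        | cons b w ih =>
          intro _
          by_cases hw : w = []
          · subst hw
            rw [hX₁]
            rcases hzz' b with rfl | rfl
            · exact Or.inl hz
            · refine Or.inr (Set.eq_empty_of_forall_notMem fun i hi => hd ⟨i, hF _ i hi⟩)
          · rcases hzz' b with rfl | rfl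
            · refine Or.inr (Set.eq_empty_of_forall_notMem fun i hi => ?_)
              obtain ⟨j, hj, -⟩ := (hX _ w hw i).1 hi
              simp [hTz] at hj
            · rcases ih hw with h | h
              · refine Or.inl (Set.eq_univ_of_forall fun i => (hX _ w hw i).2 ?_)
                obtain ⟨j, hj⟩ := Option.ne_none_iff_exists'.1 fun h' => hd ⟨i, h'⟩
                exact ⟨j, hj, h ▸ Set.mem_univ j⟩
              · refine Or.inr (Set.eq_empty_of_forall_notMem fun i hi => ?_)
                obtain ⟨j, -, hj⟩ := (hX _ w hw i).1 hi
                simp [h] at hj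
      obtain ⟨w, hw, hwS⟩ := hall {o}
      obtain ⟨l, hl, -⟩ := hι o o
      rcases htriv w hw with h | h
      · have : l ∈ ({o} : Set ι) := by
          rw [← hwS, h]
          trivial
        exact hl this
      · have : o ∈ (∅ : Set ι) := by
          rw [← h, hwS]
          rfl
        exact this
  -- The full set is now a preimage, so `T z` is a total map `t`, and `F z` is empty. The other
  -- letter must accept from some `d`, or no nonempty set would arise.
  · obtain ⟨z, h | ⟨U, hU⟩⟩ := hinv Set.univ
    · exact hfull ⟨z, h.symm⟩
    have htot : ∀ i, ∃ j, T z i = some j := fun i =>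
      let ⟨j, hj, _⟩ := (hU i).1 (Set.mem_univ i)
      ⟨j, hj⟩
    choose t ht using htot
    have hFz : F z = ∅ := Set.eq_empty_of_forall_notMem fun i hi => by
      have := hF z i hi
      simp [ht] at this
    obtain ⟨z', hzz'⟩ := hβ z
    obtain ⟨d, hd⟩ : ∃ d, d ∈ F z' := by
      by_contra hcon
      push Not at hcon
      have hempty : ∀ w : List β, w ≠ [] → X w = ∅ := by
        intro w
        induction w with
        | nil => exact fun h => absurd rfl h
        | cons b w ih =>
          intro _
          refine Set.eq_empty_of_forall_notMem fun i hi => ?_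
          by_cases hw : w = []
          · subst hw
            rw [hX₁] at hi
            rcases hzz' b with rfl | rfl
            · simp [hFz] at hi
            · exact hcon i hi
          · obtain ⟨j, -, hj⟩ := (hX _ w hw i).1 hi
            simp [ih hw] at hj
      obtain ⟨w, hw, hwS⟩ := hall Set.univ
      have : o ∈ (∅ : Set ι) := by
        rw [← hempty w hw, hwS]
        trivial
      exact this
    have hTd := hF z' d hd
    by_cases hinj : Function.Injective t
    -- If `t` is a bijection, its preimage of a proper subset is proper, and preimages under `T z'`
    -- miss `d`. Hence the full set never arises.
    · have hsurj := Finite.surjective_of_injective hinj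
      have hne : ∀ w : List β, w ≠ [] → X w ≠ Set.univ := by
        intro w
        induction w with
        | nil => exact fun h => absurd rfl h
        | cons b w ih =>
          intro _ hw1
          by_cases hw : w = []
          · subst hw
            rw [hX₁] at hw1
            exact hfull ⟨b, hw1⟩
          · rcases hzz' b with rfl | rfl
            · refine ih hw (Set.eq_univ_of_forall fun i => ?_)
              obtain ⟨k, rfl⟩ := hsurj i
              obtain ⟨j, hj, hjw⟩ := (hX _ w hw k).1 (hw1 ▸ Set.mem_univ k)
              rw [ht, Option.some.injEq] at hj
              rwa [hj]
            · obtain ⟨j, hj, -⟩ := (hX _ w hw d).1 (hw1 ▸ Set.mem_univ d)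
              simp [hTd] at hj
      obtain ⟨w, hw, hwS⟩ := hall Set.univ
      exact hne w hw hwS
    · obtain ⟨i, j, hij, hne⟩ : ∃ i j, t i = t j ∧ i ≠ j := by
        simpa [Function.Injective] using hinj
      -- If `t` merges `i` and `j`, preimages under `t` do not separate them, and preimages under `T
      -- z'` miss `d`. So `F z'` is the only set containing `d` that separates `i` from `j`; in each
      -- case below two such sets are exhibited.
      have key : ∀ S : Set ι, d ∈ S → ¬ (i ∈ S ↔ j ∈ S) → S = F z' := by
        intro S hdS hsep
        obtain ⟨b, h | ⟨S', hS'⟩⟩ := hinv S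
        · rcases hzz' b with rfl | rfl
          · rw [h, hFz] at hdS
            exact absurd hdS (Set.notMem_empty d)
          · exact h
        · rcases hzz' b with rfl | rfl
          · exact absurd (by rw [hS', hS', ht, ht, hij]) hsep
          · obtain ⟨k, hk, -⟩ := (hS' d).1 hdS
            simp [hTd] at hk
      obtain ⟨l, hli, hlj⟩ := hι i j
      have hcontra : ∀ (A B : Set ι) (k : ι), A = F z' → B = F z' → k ∈ A → k ∈ B := by
        rintro A B k rfl rfl h
        exact h
      by_cases hdi : d = i
      · subst hdi
        have := hcontra _ _ l (key {d, l} (by simp) (by simp [hne.symm, hlj.symm]))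
          (key {d} (by simp) (by simp [hne.symm])) (by simp)
        exact hli this
      · by_cases hdj : d = j
        · subst hdj
          have := hcontra _ _ l (key {d, l} (by simp) (by simp [hne, hli.symm]))
            (key {d} (by simp) (by simp [hne])) (by simp)
          exact hlj this
        · have := hcontra _ _ i (key {d, i} (by simp) (by simp [hne.symm, Ne.symm hdj]))
            (key {d, j} (by simp) (by simp [hne, Ne.symm hdi])) (by simp)
          rcases this with h | h
          · exact hdi h.symm
          · exact hne h

theorem exists_other_letter {β : Type} [Finite β] (h : Nat.card β < 3) (z : β) :
    ∃ z', ∀ b, b = z ∨ b = z' := by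
  classical
  by_contra hcon
  push Not at hcon
  obtain ⟨x, hx, -⟩ := hcon z
  obtain ⟨y, hyz, hyx⟩ := hcon x
  have := Fintype.ofFinite β
  have hle := Finset.card_le_univ {z, x, y}
  rw [Finset.card_eq_three.2 ⟨z, x, y, hx.symm, hyz.symm, hyx.symm, rfl⟩,
    ← Nat.card_eq_fintype_card] at hle
  omega

theorem needsLetters₁_reverse {n : ℕ} (hn : 5 ≤ n) :
    NeedsLetters₁ (fun _ L => κ L.reverse) n (2 ^ (n - 2) + 1) 3 := by
  classical
  intro β _ L h hκ
  by_contra! hlt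
  obtain ⟨P, hcard, hnil, h0, hP⟩ := h.exists_finset (by omega)
  have hall := exists_forall_mem_iff_of_κ_reverse_eq hcard hP hκ
  have hcardP : Fintype.card P = n - 2 := by rw [Fintype.card_coe, hcard]
  have : Nonempty P := Fintype.card_pos_iff.1 (by omega)
  have hι : ∀ i j : P, ∃ l, l ≠ i ∧ l ≠ j := by
    intro i j
    by_contra! hcon
    have hsub : (Finset.univ : Finset P) ⊆ {i, j} := fun l _ => by
      rw [Finset.mem_insert, Finset.mem_singleton]
      exact or_iff_not_imp_left.2 (hcon l)
    have := (Finset.card_le_card hsub).trans Finset.card_le_two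
    rw [Finset.card_univ] at this
    omega
  have hmem : ∀ K ∈ P, K ∈ Set.range L.leftQuotient := fun K hK => by
    rw [hP]
    simp [hK]
  have h1 : (1 : Language β) ∉ P := fun h => hnil 1 h Language.nil_mem_one
  -- The elements are the `n - 2 ≥ 3` quotients in `P`. A letter acts as a partial map on them,
  -- undefined where the result is `{ε}` (the set `F b`) or `∅`.
  refine not_forall_exists_accepting_eq hι (exists_other_letter hlt)
    (fun w => {K : P | w ∈ K.1})
    (fun b K => if hK : K.1.leftQuotient [b] ∈ P then some ⟨_, hK⟩ else none)
    (fun b => {K : P | K.1.leftQuotient [b] = 1}) ?_ ?_ ?_ ?_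
  · intro b
    ext K
    constructor
    · intro hK
      exact h.1.eq_one (exists_leftQuotient_leftQuotient (hmem _ K.2) _) hK
    · intro hK
      have : [] ∈ K.1.leftQuotient [b] := (show _ = _ from hK) ▸ Language.nil_mem_one
      exact this
  · intro b w hw K
    have hmem' := exists_leftQuotient_leftQuotient (hmem _ K.2) [b]
    rw [hP] at hmem'
    change w ∈ K.1.leftQuotient [b] ↔ _
    rcases hmem' with h' | h' | h'
    · simp [h', h0]
    · simp [h', h1, Language.mem_one, hw]
    · have h' : K.1.leftQuotient [b] ∈ P := h'
      rw [dif_pos h']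
      simp only [Option.some.injEq, exists_eq_left']
      rfl
  · intro b K hK
    have hK : K.1.leftQuotient [b] = 1 := hK
    rw [dif_neg (by rwa [hK])]
  · intro S
    obtain ⟨x, hx, hxS⟩ := hall {K | ∃ hK : K ∈ P, (⟨K, hK⟩ : P) ∈ S}
    refine ⟨x, hx, ?_⟩
    ext K
    rw [Set.mem_ofPred_eq, hxS K.1 K.2]
    simp

/-! #### The witness for reversal -/

/-- The states below `n - 2` from which some nonempty word is accepted are those that satisfy `S`. -/
def IsAcceptingSet {β : Type} (n : ℕ) (σ : β → Letter) (S : ℕ → Prop) : Prop :=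
  ∃ x : List β, x ≠ [] ∧ ∀ q < n - 2, run n (x.map σ) q = n - 2 ↔ S q

section Witness

variable {β : Type} {n : ℕ} {σ : β → Letter}

theorem IsAcceptingSet.congr {S S' : ℕ → Prop} (h : IsAcceptingSet n σ S)
    (hS : ∀ q < n - 2, S q ↔ S' q) : IsAcceptingSet n σ S' :=
  let ⟨x, hx, hxS⟩ := h
  ⟨x, hx, fun q hq => (hxS q hq).trans (hS q hq)⟩

theorem IsAcceptingSet.prepend {S : ℕ → Prop} (h : IsAcceptingSet n σ S) (u : List β)
    (hu : ∀ q < n - 2, run n (u.map σ) q < n - 2) :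
    IsAcceptingSet n σ fun q => S (run n (u.map σ) q) := by
  obtain ⟨x, hx, hxS⟩ := h
  refine ⟨u ++ x, by simp [hx], fun q hq => ?_⟩
  rw [List.map_append, run_append, hxS _ (hu q hq)]

variable {b c e : β}

/-- Conjugating `c` by the cycle gives the map that sends `i + 1` to `i` and fixes the rest: `i + 1`
is turned to `1`, merged into `0`, and the turn is completed to `n - 2` steps. -/
theorem IsAcceptingSet.copy (hb : σ b = .a) (hc : σ c = .c) {S : ℕ → Prop}
    (h : IsAcceptingSet n σ S) {i : ℕ} (hi : i + 1 < n - 2) :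
    IsAcceptingSet n σ fun q => S (if q = i + 1 then i else q) := by
  have hrun : ∀ q < n - 2, run n ((List.replicate (n - 2 + 1 - (i + 1)) b ++ ([c] ++
      List.replicate i b)).map σ) q = if q = i + 1 then i else q := by
    intro q hq
    simp only [List.map_append, List.map_replicate, List.map_cons, List.map_nil, hb, hc]
    have hlt : (q + (n - 2 + 1 - (i + 1))) % (n - 2) < n - 2 := Nat.mod_lt _ (by omega)
    have hone := add_mod_eq_iff hq hi (show 1 < n - 2 by omega)
    rw [run_append, run_replicate_a _ hq, run_append, run_cons, run_nil]
    by_cases h : q = i + 1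
    · rw [if_pos h, hone.2 h, show act n .c 1 = 0 by simp [act], run_replicate_a _ (by omega),
        zero_add, Nat.mod_eq_of_lt (by omega)]
    · have hact : act n .c ((q + (n - 2 + 1 - (i + 1))) % (n - 2)) =
          (q + (n - 2 + 1 - (i + 1))) % (n - 2) := by
        simp only [act]
        rw [if_neg (by rwa [hone]), if_neg hlt.ne]
      rw [if_neg h, hact, run_replicate_a _ hlt, Nat.mod_add_mod,
        show q + (n - 2 + 1 - (i + 1)) + i = q + (n - 2) by omega, Nat.add_mod_right,
        Nat.mod_eq_of_lt hq]
  refine (h.prepend _ fun q hq => ?_).congr fun q hq => by rw [hrun q hq]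
  rw [hrun q hq]
  split_ifs <;> omega

/-- The cycle turns `i` to `n - 3`, where `e` makes it final, and the letters that follow kill it.
All other states return to their places after two full turns. -/
theorem IsAcceptingSet.erase (hn : 4 ≤ n) (hb : σ b = .a) (he : σ e = .e) {S : ℕ → Prop}
    (h : IsAcceptingSet n σ S) {i : ℕ} (hi : i < n - 2) :
    IsAcceptingSet n σ fun q => q ≠ i ∧ S q := by
  obtain ⟨x, hx, hxS⟩ := h
  refine ⟨List.replicate (n - 2 + (n - 3) - i) b ++ ([e] ++ (List.replicate (i + 1) b ++ x)),
    by simp, fun q hq => ?_⟩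
  simp only [List.map_append, List.map_replicate, List.map_cons, List.map_nil, hb, he]
  have hlt : (q + (n - 2 + (n - 3) - i)) % (n - 2) < n - 2 := Nat.mod_lt _ (by omega)
  have hlast := add_mod_eq_iff hq hi (show n - 3 < n - 2 by omega)
  rw [run_append, run_replicate_a _ hq, run_append, run_cons, run_nil]
  by_cases h : q = i
  · rw [hlast.2 h, act_e_eq, run_final hn (by simp)]
    simp only [h, ne_eq, not_true_eq_false, false_and, iff_false]
    omega
  · have hlt' : (q + (n - 2 + (n - 3) - i)) % (n - 2) < n - 3 := by
      have := mt hlast.1 h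
      omega
    rw [act_e hlt', run_append, run_replicate_a _ hlt, Nat.mod_add_mod,
      show q + (n - 2 + (n - 3) - i) + (i + 1) = q + (n - 2) + (n - 2) by omega, Nat.add_mod_right,
      Nat.add_mod_right, Nat.mod_eq_of_lt hq, hxS q hq]
    simp [h]

theorem isAcceptingSet_of_a_c_e (hn : 4 ≤ n) (hb : σ b = .a) (hc : σ c = .c) (he : σ e = .e)
    (S : ℕ → Prop) : IsAcceptingSet n σ S := by
  classical
  -- Starting from a word accepted from `0` alone, merging `j + 1` into `j` extends the accepting
  -- set from `{0, …, j}` to `{0, …, j + 1}`.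
  have hinit : ∀ j < n - 2, IsAcceptingSet n σ fun q => q ≤ j := by
    intro j
    induction j with
    | zero =>
      intro _
      obtain ⟨w, hw⟩ := sep_of_a (n := n) (σ := σ) (c := e) (r := n - 3) (by omega) hb
        (fun p hp => by rw [he, act_e_eq_final_iff hn p hp]) 0 (by omega)
      refine ⟨w, ?_, fun q hq => by rw [hw q hq]; omega⟩
      rintro rfl
      have := (hw 0 (by omega)).2 rfl
      rw [List.map_nil, run_nil] at this
      omega
    | succ j ih =>
      intro hj
      refine ((ih (by omega)).copy hb hc hj).congr fun q _ => ?_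
      split_ifs <;> omega
  have hfin : ∀ D : Finset ℕ, (∀ i ∈ D, i < n - 2) → IsAcceptingSet n σ fun q => q ∉ D := by
    intro D
    induction D using Finset.induction_on with
    | empty =>
      intro _
      exact (hinit (n - 3) (by omega)).congr fun q hq => by simp; omega
    | insert i D _ ih =>
      intro hD
      refine ((ih fun j hj => hD j (by simp [hj])).erase hn hb he (hD i (by simp))).congr
        fun q _ => by simp
  refine (hfin ((Finset.range (n - 2)).filter fun q => ¬ S q) (by simp +contextual)).congr
    fun q hq => by simp [hq]

theorem κ_reverse_stateLang (hn : 4 ≤ n) (hb : σ b = .a) (hc : σ c = .c) (he : σ e = .e) :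
    κ (stateLang n σ 0).reverse = (2 ^ (n - 2) + 1 : ℕ) := by
  classical
  have hreach := reach_of_a (n := n) hb
  have hsep := sep_of_a (n := n) (σ := σ) (c := e) (r := n - 3) (by omega) hb
    fun p hp => by rw [he, act_e_eq_final_iff hn p hp]
  refine le_antisymm (κ_reverse_le hn (isPrefixFreeOf_stateLang hn σ b hreach hsep)) ?_
  have hmem : ∀ (w x : List β), w ++ x ∈ stateLang n σ 0 ↔ x ∈ stateLang n σ (run n (w.map σ) 0) :=
    fun w x => by rw [← leftQuotient_stateLang, Language.mem_leftQuotient]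
  -- Every state is reachable, so equal left contexts mean acceptance from the same states; the
  -- final state tells whether the word is empty. Thus left contexts determine signatures.
  have hle : (Set.range (signature (Finset.range (n - 2)) (stateLang n σ))).encard ≤
      κ (stateLang n σ 0).reverse := by
    rw [κ_reverse_eq]
    refine encard_range_le_of_factors fun x y hxy => ?_
    have hxy : ∀ q < n, x ∈ stateLang n σ q ↔ y ∈ stateLang n σ q := fun q hq => by
      obtain ⟨w, rfl⟩ := exists_run_eq hn σ b hreach hsep hq
      rw [← hmem, ← hmem, ← mem_leftContexts, hxy, mem_leftContexts]
    have hnil := hxy (n - 2) (by omega)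
    rw [stateLang_eq_one hn, Language.mem_one, Language.mem_one] at hnil
    simp only [signature, hnil]
    congr 2
    exact Finset.filter_congr fun q hq => hxy q (by rw [Finset.mem_range] at hq; omega)
  refine le_trans ?_ hle
  have hcard := card_signatures (Finset.range (n - 2))
  rw [Finset.card_range] at hcard
  rw [← hcard, ← Set.encard_coe_eq_coe_finsetCard]
  refine Set.encard_le_encard fun s hs => ?_
  rw [Finset.mem_coe] at hs
  cases s with
  | none => exact ⟨[], by simp [signature]⟩
  | some S =>
    have hS := Finset.some_mem_insertNone.1 hs
    obtain ⟨x, hx, hxS⟩ := isAcceptingSet_of_a_c_e (n := n) hn hb hc he (· ∈ S)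
    refine ⟨x, ?_⟩
    rw [signature, if_neg hx]
    congr 1
    ext q
    rw [Finset.mem_filter, Finset.mem_range, mem_stateLang]
    rw [Finset.mem_powerset] at hS
    constructor
    · exact fun h => (hxS q h.1).1 h.2
    · exact fun h => ⟨Finset.mem_range.1 (hS h), (hxS q (Finset.mem_range.1 (hS h))).2 h⟩

end Witness

/-! ### The dialects as state languages, and the bounds they meet -/

theorem streamDialect_a_f {n : ℕ} (hn : 4 ≤ n) :
    streamDialect n hn (β := Fin 2) (some 0) none none none (some 1) none =
      stateLang n ![.a, .f] 0 :=
  dialect_eq hn _ _ fun x b => by cases x <;> fin_cases b <;> simp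

theorem streamDialect_a_c_e {n : ℕ} (hn : 4 ≤ n) :
    streamDialect n hn (β := Fin 3) (some 0) (some 1) none (some 2) none none =
      stateLang n ![.a, .c, .e] 0 :=
  dialect_eq hn _ _ fun x b => by cases x <;> fin_cases b <;> simp

theorem streamDialect_a_d {n : ℕ} (hn : 4 ≤ n) :
    streamDialect n hn (β := Fin 2) (some 0) none (some 1) none none none =
      stateLang n ![.a, .d] 0 :=
  dialect_eq hn _ _ fun x b => by cases x <;> fin_cases b <;> simp

theorem streamDialect_a_e {n : ℕ} (hn : 4 ≤ n) :
    streamDialect n hn (β := Fin 2) (some 0) none none (some 1) none none =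
      stateLang n ![.a, .e] 0 :=
  dialect_eq hn _ _ fun x b => by cases x <;> fin_cases b <;> simp

theorem streamDialect_f {n : ℕ} (hn : 4 ≤ n) :
    streamDialect n hn (β := Fin 1) none none none none (some 0) none =
      stateLang n (fun _ => .f) 0 :=
  dialect_eq hn _ _ fun x b => by cases x <;> fin_cases b <;> simp

theorem streamDialect_f_g {n : ℕ} (hn : 4 ≤ n) :
    streamDialect n hn (β := Fin 2) none none none none (some 0) (some 1) =
      stateLang n ![.f, .g] 0 :=
  dialect_eq hn _ _ fun x b => by cases x <;> fin_cases b <;> simp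

theorem streamDialect_g_f {n : ℕ} (hn : 4 ≤ n) :
    streamDialect n hn (β := Fin 2) none none none none (some 1) (some 0) =
      stateLang n ![.g, .f] 0 :=
  dialect_eq hn _ _ fun x b => by cases x <;> fin_cases b <;> simp

theorem isPrefixFreeOf_of_f {β : Type} {n : ℕ} (hn : 4 ≤ n) {σ : β → Letter} {b : β}
    (hb : σ b = .f) : IsPrefixFreeOf n (stateLang n σ 0) :=
  isPrefixFreeOf_stateLang hn σ b (reach_of_f hn hb) (sep_of_f hn hb)

theorem isPrefixFreeOf_of_a_of_e {β : Type} {n : ℕ} (hn : 4 ≤ n) {σ : β → Letter} {b c : β}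
    (hb : σ b = .a) (hc : σ c = .e) : IsPrefixFreeOf n (stateLang n σ 0) :=
  isPrefixFreeOf_stateLang hn σ b (reach_of_a hb) (sep_of_a (n := n) (r := n - 3) (by omega) hb
    fun p hp => by rw [hc, act_e_eq_final_iff hn p hp])

theorem isPrefixFreeOf_of_a_of_d {β : Type} {n : ℕ} (hn : 4 ≤ n) {σ : β → Letter} {b c : β}
    (hb : σ b = .a) (hc : σ c = .d) : IsPrefixFreeOf n (stateLang n σ 0) :=
  isPrefixFreeOf_stateLang hn σ b (reach_of_a hb) (sep_of_a (n := n) (r := 0) (by omega) hb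
    fun p hp => by rw [hc, act_d_eq_final_iff hn p hp])

theorem meets₁_reverse {n : ℕ} (hn : 4 ≤ n) :
    Meets₁ (fun _ L => κ L.reverse) n (2 ^ (n - 2) + 1)
      (streamDialect n hn (β := Fin 3) (some 0) (some 1) none (some 2) none none) := by
  rw [streamDialect_a_c_e]
  exact ⟨fun β _ L h => κ_reverse_le hn h, isPrefixFreeOf_of_a_of_e (b := 0) (c := 2) hn rfl rfl,
    κ_reverse_stateLang (b := 0) (c := 1) (e := 2) hn rfl rfl rfl⟩

theorem meets₁_kstar {n : ℕ} (hn : 4 ≤ n) :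
    Meets₁ (fun _ L => κ (L∗)) n n
      (streamDialect n hn (β := Fin 2) (some 0) none (some 1) none none none) := by
  rw [streamDialect_a_d]
  exact ⟨fun β _ L h => κ_kstar_le hn h, isPrefixFreeOf_of_a_of_d (b := 0) (c := 1) hn rfl rfl,
    κ_kstar_stateLang (b := 0) (c := 1) hn rfl rfl⟩

theorem meets₂_mul {m n : ℕ} (hm : 4 ≤ m) (hn : 4 ≤ n) :
    Meets₂ (fun _ L' L => L' * L) m n (m + n - 2)
      (streamDialect m hm (β := Fin 1) none none none none (some 0) none)
      (streamDialect n hn (β := Fin 1) none none none none (some 0) none) := by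
  rw [streamDialect_f, streamDialect_f]
  exact ⟨fun β _ L' L h' h => κ_mul_le hm hn h' h, isPrefixFreeOf_of_f (b := 0) hm rfl,
    isPrefixFreeOf_of_f (b := 0) hn rfl, κ_mul_stateLang_f hm hn⟩

theorem meets₂_sup {m n : ℕ} (hm : 4 ≤ m) (hn : 4 ≤ n) :
    Meets₂ (fun _ L' L => L' ⊔ L) m n (m * n - 2)
      (streamDialect m hm (β := Fin 2) none none none none (some 0) (some 1))
      (streamDialect n hn (β := Fin 2) none none none none (some 1) (some 0)) := by
  rw [streamDialect_f_g, streamDialect_g_f]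
  have hle : ∀ (β : Type) (L' L : Language β), IsPrefixFreeOf m L' → IsPrefixFreeOf n L →
      κ (L' ⊔ L) ≤ (m * n - 2 : ℕ) := fun β L' L h' h =>
    κ_op_le hm hn (· ⊔ ·) leftQuotient_sup (fun K => bot_sup_eq K) (sup_bot_eq _)
      (Or.inr (sup_idem _)) h' h
  have h' := isPrefixFreeOf_of_f (σ := ![.f, .g]) (b := 0) hm rfl
  have h := isPrefixFreeOf_of_f (σ := ![.g, .f]) (b := 1) hn rfl
  refine ⟨fun β _ L' L => hle β L' L, h', h, (hle _ _ _ h' h).antisymm ?_⟩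
  exact le_κ_op_stateLang (b := 0) (c := 1) hm hn rfl rfl rfl rfl (· ⊔ ·) leftQuotient_sup
    (fun K L w hw => by rw [mem_sup_language]; tauto)
    (fun K L w hw => by rw [mem_sup_language]; tauto)

theorem meets₂_symmDiff {m n : ℕ} (hm : 4 ≤ m) (hn : 4 ≤ n) :
    Meets₂ (fun _ L' L => L' ∆ L) m n (m * n - 2)
      (streamDialect m hm (β := Fin 2) none none none none (some 0) (some 1))
      (streamDialect n hn (β := Fin 2) none none none none (some 1) (some 0)) := by
  rw [streamDialect_f_g, streamDialect_g_f]
  have hle : ∀ (β : Type) (L' L : Language β), IsPrefixFreeOf m L' → IsPrefixFreeOf n L →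
      κ (L' ∆ L) ≤ (m * n - 2 : ℕ) := fun β L' L h' h =>
    κ_op_le hm hn (· ∆ ·) leftQuotient_symmDiff (fun K => bot_symmDiff K) (symmDiff_bot _)
      (Or.inl (symmDiff_self _)) h' h
  have h' := isPrefixFreeOf_of_f (σ := ![.f, .g]) (b := 0) hm rfl
  have h := isPrefixFreeOf_of_f (σ := ![.g, .f]) (b := 1) hn rfl
  refine ⟨fun β _ L' L => hle β L' L, h', h, (hle _ _ _ h' h).antisymm ?_⟩
  exact le_κ_op_stateLang (b := 0) (c := 1) hm hn rfl rfl rfl rfl (· ∆ ·) leftQuotient_symmDiff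
    (fun K L w hw => by rw [mem_symmDiff_language]; tauto)
    (fun K L w hw => by rw [mem_symmDiff_language]; tauto)

theorem meets₂_sdiff {m n : ℕ} (hm : 4 ≤ m) (hn : 4 ≤ n) :
    Meets₂ (fun _ L' L => L' \ L) m n (m * n - (m + 2 * n - 4))
      (streamDialect m hm (β := Fin 2) (some 0) none none (some 1) none none)
      (streamDialect n hn (β := Fin 2) none none none none (some 1) (some 0)) := by
  rw [streamDialect_a_e, streamDialect_g_f]
  have h' := isPrefixFreeOf_of_a_of_e (σ := ![.a, .e]) (b := 0) (c := 1) hm rfl rfl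
  have h := isPrefixFreeOf_of_f (σ := ![.g, .f]) (b := 1) hn rfl
  exact ⟨fun β _ L' L => κ_sdiff_le hm hn, h', h, (κ_sdiff_le hm hn h' h).antisymm
    (le_κ_sdiff_stateLang (b := 0) (c := 1) hm hn rfl rfl rfl rfl)⟩

theorem meets₂_inf {m n : ℕ} (hm : 4 ≤ m) (hn : 4 ≤ n) :
    Meets₂ (fun _ L' L => L' ⊓ L) m n (m * n - 2 * (m + n - 3))
      (streamDialect m hm (β := Fin 2) (some 0) none none (some 1) none none)
      (streamDialect n hn (β := Fin 2) none none none none (some 1) (some 0)) := by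
  rw [streamDialect_a_e, streamDialect_g_f]
  have h' := isPrefixFreeOf_of_a_of_e (σ := ![.a, .e]) (b := 0) (c := 1) hm rfl rfl
  have h := isPrefixFreeOf_of_f (σ := ![.g, .f]) (b := 1) hn rfl
  exact ⟨fun β _ L' L => κ_inf_le hm hn, h', h, (κ_inf_le hm hn h' h).antisymm
    (le_κ_inf_stateLang (b := 0) (c := 1) hm hn rfl rfl rfl rfl)⟩

/-- With `4 + m` and `4 + n` for the complexities, the three bounds are at least `14`, `8` and `6`
plus `m + n`, while the maximum is at most `4 + m + n`. -/
theorem max_lt_bounds {m n : ℕ} (hm : 4 ≤ m) (hn : 4 ≤ n) : max m n < m * n - 2 ∧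
    max m n < m * n - (m + 2 * n - 4) ∧ max m n < m * n - 2 * (m + n - 3) := by
  obtain ⟨m, rfl⟩ := Nat.exists_eq_add_of_le hm
  obtain ⟨n, rfl⟩ := Nat.exists_eq_add_of_le hn
  have : (4 + m) * (4 + n) = 16 + 4 * m + 4 * n + m * n := by ring
  rw [this]
  omega

end PrefixFreeStream

open PrefixFreeStream in
theorem mainTheorem6 :
    -- the DFA is minimal, and its language is prefix-free of complexity `n`
    (∀ (n : ℕ) (hn : 4 ≤ n),
      IsMinimal (streamDFA n hn) ∧ IsPrefixFreeOf n (stream n hn)) ∧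
    -- quotients: two letters
    (∀ (n : ℕ) (hn : 4 ≤ n),
      (∀ (β : Type) [Finite β] (L : Language β), IsPrefixFreeOf n L → QuotientsBounded n L) ∧
      IsPrefixFreeOf n
        (streamDialect n hn (β := Fin 2) (some 0) none none none (some 1) none) ∧
      QuotientsMeet n
        (streamDialect n hn (β := Fin 2) (some 0) none none none (some 1) none) ∧
      (∀ (β : Type) [Finite β] (L : Language β), IsPrefixFreeOf n L → QuotientsMeet n L →
        2 ≤ Nat.card β)) ∧
    -- reversal and number of atoms: three letters
    (∀ (n : ℕ) (hn : 4 ≤ n),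
      Meets₁ (fun _ L => κ L.reverse) n (2 ^ (n - 2) + 1)
        (streamDialect n hn (β := Fin 3) (some 0) (some 1) none (some 2) none none) ∧
      Meets₁ (fun _ L => (atoms L).encard) n (2 ^ (n - 2) + 1)
        (streamDialect n hn (β := Fin 3) (some 0) (some 1) none (some 2) none none) ∧
      (5 ≤ n →
        NeedsLetters₁ (fun _ L => κ L.reverse) n (2 ^ (n - 2) + 1) 3 ∧
        NeedsLetters₁ (fun _ L => (atoms L).encard) n (2 ^ (n - 2) + 1) 3)) ∧
    -- star: two letters
    (∀ (n : ℕ) (hn : 4 ≤ n),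
      Meets₁ (fun _ L => κ (L∗)) n n
        (streamDialect n hn (β := Fin 2) (some 0) none (some 1) none none none) ∧
      NeedsLetters₁ (fun _ L => κ (L∗)) n n 2) ∧
    -- product: one letter
    (∀ (m n : ℕ) (hm : 4 ≤ m) (hn : 4 ≤ n),
      Meets₂ (fun _ L' L => L' * L) m n (m + n - 2)
        (streamDialect m hm (β := Fin 1) none none none none (some 0) none)
        (streamDialect n hn (β := Fin 1) none none none none (some 0) none) ∧
      NeedsLetters₂ (fun _ L' L => L' * L) m n (m + n - 2) 1) ∧
    -- union and symmetric difference: two letters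
    (∀ (m n : ℕ) (hm : 4 ≤ m) (hn : 4 ≤ n),
      Meets₂ (fun _ L' L => L' ⊔ L) m n (m * n - 2)
        (streamDialect m hm (β := Fin 2) none none none none (some 0) (some 1))
        (streamDialect n hn (β := Fin 2) none none none none (some 1) (some 0)) ∧
      NeedsLetters₂ (fun _ L' L => L' ⊔ L) m n (m * n - 2) 2 ∧
      Meets₂ (fun _ L' L => L' ∆ L) m n (m * n - 2)
        (streamDialect m hm (β := Fin 2) none none none none (some 0) (some 1))
        (streamDialect n hn (β := Fin 2) none none none none (some 1) (some 0)) ∧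
      NeedsLetters₂ (fun _ L' L => L' ∆ L) m n (m * n - 2) 2) ∧
    -- difference and intersection: two letters
    (∀ (m n : ℕ) (hm : 4 ≤ m) (hn : 4 ≤ n),
      Meets₂ (fun _ L' L => L' \ L) m n (m * n - (m + 2 * n - 4))
        (streamDialect m hm (β := Fin 2) (some 0) none none (some 1) none none)
        (streamDialect n hn (β := Fin 2) none none none none (some 1) (some 0)) ∧
      NeedsLetters₂ (fun _ L' L => L' \ L) m n (m * n - (m + 2 * n - 4)) 2 ∧
      Meets₂ (fun _ L' L => L' ⊓ L) m n (m * n - 2 * (m + n - 3))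
        (streamDialect m hm (β := Fin 2) (some 0) none none (some 1) none none)
        (streamDialect n hn (β := Fin 2) none none none none (some 1) (some 0)) ∧
      NeedsLetters₂ (fun _ L' L => L' ⊓ L) m n (m * n - 2 * (m + n - 3)) 2) := by
  refine ⟨fun n hn => ⟨isMinimal_streamDFA hn, isPrefixFreeOf_stream hn⟩, fun n hn => ?_,
    fun n hn => ?_, fun n hn => ⟨meets₁_kstar hn, needsLetters₁_kstar hn⟩,
    fun m n hm hn => ⟨meets₂_mul hm hn, needsLetters₂_mul hm⟩,
    fun m n hm hn => ⟨meets₂_sup hm hn, needsLetters₂_two hm hn (fun _ _ _ _ hw => hw)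
        (max_lt_bounds hm hn).1, meets₂_symmDiff hm hn,
      needsLetters₂_two hm hn (fun _ _ _ _ hw => hw.imp And.left And.left)
        (max_lt_bounds hm hn).1⟩,
    fun m n hm hn => ⟨meets₂_sdiff hm hn, needsLetters₂_two hm hn
        (fun _ _ _ _ hw => Or.inl hw.1) (max_lt_bounds hm hn).2.1, meets₂_inf hm hn,
      needsLetters₂_two hm hn (fun _ _ _ _ hw => Or.inl hw.1) (max_lt_bounds hm hn).2.2⟩⟩
  · rw [streamDialect_a_f]
    exact ⟨fun β _ L h => h.quotientsBounded, isPrefixFreeOf_of_f (b := 1) hn rfl,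
      quotientsMeet_stateLang (b := 0) (c := 1) hn rfl rfl,
      fun β _ L h hL => hL.two_le_card hn h⟩
  · simp only [encard_atoms]
    exact ⟨meets₁_reverse hn, meets₁_reverse hn,
      fun h5 => ⟨needsLetters₁_reverse h5, needsLetters₁_reverse h5⟩⟩
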